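/- For $v\in\mathbb R^2=\mathbb C$ let $\tau_v$ be the translation $x\mapsto x+v$ and for $\theta\in\mathbb R$ let $\rho_\theta$ be the rotation $x\mapsto e^{i\theta}x$ of the plane. Let $\theta\in\mathbb R$ with $\cos\theta\in\mathbb Q\setminus\frac12\mathbb Z$, and let $\mu$ be a probability measure on $\mathrm{Isom}(\mathbb R^2)$ of one of the following two kinds: 1. (Littlewood polynomials) $\mu$ is the uniform distribution on $\{\tau_1\rho_\theta,\tau_{-1}\rho_\theta\}$; 2. (asymmetric wreath product) $\operatorname{supp}\mu=\{\rho_\theta,\rho_{-\theta},\tau_1,\tau_{-1}\}$ with $\mu(\{\tau_1\})=\mu(\{\tau_{-1}\})$ and $\mu(\{\rho_\theta\})\neq\mu(\{\rho_{-\theta}\})$. Let $g_1,g_2,\dots$ be independent random isometries with law $\mu$, let $Y_N:=(g_1g_2\cdots g_N)(0)$, and let $\sigma\ge 0$ be given by $\sigma^2:=\frac12\mathbf E|g_1(0)|^2$. Then there are constants $c>0$ and $C>0$, depending only on $\mu$, such that for every integer $N\ge 2$, every $x_0\in\mathbb R^2$ and every $r>\exp(-c\sqrt N/\log N)$, $$\bigl|\mathbb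 P(Y_N\in B_r(x_0))-\mathbb P(\sigma\sqrt N\,Z_1\in B_r(x_0))\bigr|\le C N^{-3/2}r^2,$$ where $Z_1$ is the standard Gaussian on $\mathbb R^2$ and $B_r(x_0)$ is the open disc of radius $r$ about $x_0$. -/

import Mathlib

open MeasureTheory ProbabilityTheory

namespace PlanarWalk

noncomputable section

/-- The Borel σ-algebra of the isometry group of the plane `ℂ = ℝ²`: the one generated by the
evaluation maps `g ↦ g x`. -/
instance instMeasurableSpaceIsom : MeasurableSpace (ℂ ≃ᵢ ℂ) :=
  MeasurableSpace.comap (fun (g : ℂ ≃ᵢ ℂ) (x : ℂ) => g x) MeasurableSpace.pi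

/-- The translation `x ↦ x + v` of the plane. -/
def τ (v : ℂ) : ℂ ≃ᵢ ℂ := IsometryEquiv.addRight v

/-- The rotation `x ↦ e^{iθ} x` of the plane. -/
def ρ (θ : ℝ) : ℂ ≃ᵢ ℂ := (rotation (Circle.exp θ)).toIsometryEquiv

/-- The Littlewood polynomial measure: `μ` is uniformly distributed on the two (distinct)
isometries `τ₁ ∘ ρ_θ` and `τ₋₁ ∘ ρ_θ`. -/
def IsLittlewood (θ : ℝ) (μ : PMF (ℂ ≃ᵢ ℂ)) : Prop :=
  μ (τ 1 * ρ θ) = 2⁻¹ ∧ μ (τ (-1) * ρ θ) = 2⁻¹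

/-- `μ` generates an asymmetric wreath product. -/
structure IsAsymmetricWreath (θ : ℝ) (μ : PMF (ℂ ≃ᵢ ℂ)) : Prop where
  support_eq : μ.support = {ρ θ, ρ (-θ), τ 1, τ (-1)}
  translation_eq : μ (τ 1) = μ (τ (-1))
  rotation_ne : μ (ρ θ) ≠ μ (ρ (-θ))

/-- `g 0, g 1, …` are independent random isometries, each with law `μ`. -/
structure IsIIDSample {Ω : Type*} [MeasurableSpace Ω] (P : Measure Ω) (g : ℕ → Ω → (ℂ ≃ᵢ ℂ))
    (μ : PMF (ℂ ≃ᵢ ℂ)) : Prop where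
  hasLaw : ∀ j, HasLaw (g j) μ.toMeasure P
  indep : iIndepFun g P

/-- The random walk `Y_N = (g₁ g₂ ⋯ g_N)(0)`; the factor `g_j` is `g (j - 1)` here, and the
product in the group `ℂ ≃ᵢ ℂ` is composition. -/
def walk {Ω : Type*} (g : ℕ → Ω → (ℂ ≃ᵢ ℂ)) (N : ℕ) (ω : Ω) : ℂ :=
  (List.ofFn fun j : Fin N => g j ω).prod 0

/-- The number `σ ≥ 0` with `σ² = ½ 𝔼 |g(0)|²`, where `g` has law `μ`. -/
def stdDev (μ : PMF (ℂ ≃ᵢ ℂ)) : ℝ :=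
  √(1 / 2 * ∫ g, ‖g 0‖ ^ 2 ∂μ.toMeasure)

end

end PlanarWalk

/-!
Let `u` be the linear part of the drift. The characteristic function of the walk evolves under a
transfer operator that averages over `u ξ`, `u⁻¹ ξ` and `ξ`, with a factor `cos (re ξ)` for a
signed translation.

At high frequency, write `2 re u = a / b` in lowest terms; then `b ≥ 2`. If the numbers
`re (u ^ j ξ)` stay near `π ℤ`, the nearest integers satisfy
`b n (j + 2) - a n (j + 1) + b n j = 0`, so a high power of `b` divides one of them. Hence
`O(log ‖ξ‖)` rotations suffice to bring the real part away from `π ℤ`, where the cosine contracts.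
As the walk drifts, a function affine in this hitting time is a Lyapunov function for the transfer
operator and gives exponential decay at rate `1 / log ‖ξ‖`, hence `exp (-c √N)` for `N` steps,
uniformly in `ξ` up to a factor linear in `‖ξ‖`. This limits the scale `r`.

At low frequency, a quadratic corrector `re (C ξ ^ 2)` turns the Gaussian into an approximate
eigenfunction, so the characteristic functions differ by `O(1 / N)`, with Gaussian decay on the
scale `N ^ (-1 / 2)`; integrated over frequencies this is `O(1 / N ^ 2)`.

Fourier inversion then compares the densities after convolution with a Gaussian whose width is a
small multiple of `r / N ^ 2`, and monotonicity of discs in the radius removes the smoothing.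
-/

namespace PlanarWalk

open ComplexConjugate
open scoped ENNReal

section NearIntegers

theorem pow_dvd_of_recurrence {R : Type*} [CommRing R] {a b : R} (hab : IsCoprime a b)
    {n : ℕ → R} {L : ℕ} (h : ∀ j, j + 2 ≤ L → b * n (j + 2) - a * n (j + 1) + b * n j = 0)
    (k : ℕ) : ∀ j, k ≤ j → j + k ≤ L → b ^ k ∣ n j := by
  induction k with
  | zero => simp
  | succ k ih =>
    intro j hj hL
    obtain ⟨i, rfl⟩ : ∃ i, j = i + 1 := ⟨j - 1, by omega⟩
    obtain ⟨x, hx⟩ := ih (i + 2) (by omega) (by omega)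
    obtain ⟨y, hy⟩ := ih i (by omega) (by omega)
    have hdvd : b ^ (k + 1) ∣ a * n (i + 1) :=
      ⟨x + y, by linear_combination b * hx + b * hy - h i (by omega)⟩
    exact hab.symm.pow_left.dvd_of_dvd_mul_left hdvd

theorem round_recurrence {a b : ℤ} {ε : ℝ} (hε : (|(a : ℝ)| + 2 * |(b : ℝ)|) * ε < 1)
    {x : ℕ → ℝ} {L : ℕ}
    (hx : ∀ j, j + 2 ≤ L → b * x (j + 2) - a * x (j + 1) + b * x j = 0)
    (hround : ∀ j ≤ L, |x j - round (x j)| ≤ ε) (j : ℕ) (hj : j + 2 ≤ L) :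
    b * round (x (j + 2)) - a * round (x (j + 1)) + b * round (x j) = 0 := by
  rw [← Int.abs_lt_one_iff, ← Int.cast_lt (R := ℝ), Int.cast_abs, Int.cast_one]
  calc |((b * round (x (j + 2)) - a * round (x (j + 1)) + b * round (x j) : ℤ) : ℝ)|
      = |a * (x (j + 1) - round (x (j + 1))) + -(b * (x (j + 2) - round (x (j + 2))))
          + -(b * (x j - round (x j)))| := by
        congr 1; push_cast; linear_combination hx j hj
    _ ≤ |(a : ℝ)| * |x (j + 1) - round (x (j + 1))|
          + |(b : ℝ)| * |x (j + 2) - round (x (j + 2))| + |(b : ℝ)| * |x j - round (x j)| := by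
        simpa only [abs_neg, abs_mul] using abs_add_three (a * (x (j + 1) - round (x (j + 1))))
          (-(b * (x (j + 2) - round (x (j + 2))))) (-(b * (x j - round (x j))))
    _ ≤ |(a : ℝ)| * ε + |(b : ℝ)| * ε + |(b : ℝ)| * ε := by
        gcongr <;> exact hround _ (by omega)
    _ < 1 := by linarith

/-- Divisibility by a high power of `b` defeats the size bound on the nearest integers. -/
theorem round_eq_zero_of_recurrence {a b : ℤ} (hab : IsCoprime a b) {ε : ℝ}
    (hε : (|(a : ℝ)| + 2 * |(b : ℝ)|) * ε < 1) {x : ℕ → ℝ} {L k : ℕ}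
    (hx : ∀ j, j + 2 ≤ L → b * x (j + 2) - a * x (j + 1) + b * x j = 0)
    (hround : ∀ j ≤ L, |x j - round (x j)| ≤ ε) {j : ℕ} (hkj : k ≤ j) (hjk : j + k ≤ L)
    (hsize : |x j| + ε < |(b : ℝ)| ^ k) : round (x j) = 0 := by
  refine Int.eq_zero_of_abs_lt_dvd ((abs_dvd _ _).2 <| pow_dvd_of_recurrence hab
    (n := fun i => round (x i)) (round_recurrence hε hx hround) k j hkj hjk) ?_
  have h := abs_sub_abs_le_abs_sub (round (x j) : ℝ) (x j)
  rw [abs_sub_comm] at h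
  rw [← Int.cast_lt (R := ℝ), Int.cast_abs, Int.cast_abs, Int.cast_pow, abs_pow]
  linarith [hround j (by omega)]

end NearIntegers

section Rotation

theorem abs_cos_le_of_le_dist_int {ε x : ℝ} (hε : 0 ≤ ε)
    (h : ε ≤ |x / Real.pi - round (x / Real.pi)|) : |Real.cos x| ≤ 1 - 2 * ε ^ 2 := by
  set t := x / Real.pi - round (x / Real.pi)
  have hx : x - round (x / Real.pi) * Real.pi = t * Real.pi := by
    simp only [t]; field_simp
  have ht : |t * Real.pi| ≤ Real.pi / 2 := by
    rw [abs_mul, abs_of_pos Real.pi_pos]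
    nlinarith [abs_sub_round (x / Real.pi), Real.pi_pos]
  have hcos : |Real.cos x| = Real.cos (t * Real.pi) := by
    rw [← abs_of_nonneg (Real.cos_nonneg_of_mem_Icc (abs_le.1 ht)), ← hx,
      Real.cos_sub_int_mul_pi, abs_mul, abs_zpow, abs_neg, abs_one, one_zpow, one_mul]
  calc |Real.cos x| ≤ 1 - 2 / Real.pi ^ 2 * (t * Real.pi) ^ 2 :=
        hcos ▸ Real.cos_le_one_sub_mul_cos_sq (ht.trans (by linarith [Real.pi_pos]))
    _ = 1 - 2 * |t| ^ 2 := by rw [sq_abs]; field_simp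
    _ ≤ 1 - 2 * ε ^ 2 := by gcongr

theorem exists_isCoprime_of_rat {x : ℝ} (hrat : ∃ q : ℚ, x = q) (hhalf : ¬ ∃ k : ℤ, x = k / 2) :
    ∃ a b : ℤ, IsCoprime a b ∧ 2 ≤ b ∧ 2 * x * b = a := by
  obtain ⟨q, rfl⟩ := hrat
  have hnum : 2 * (q : ℝ) * ((2 * q).den : ℤ) = (2 * q).num := by
    exact_mod_cast Rat.mul_den_eq_num (2 * q)
  refine ⟨(2 * q).num, (2 * q).den, ?_, ?_, hnum⟩
  · exact Int.isCoprime_iff_gcd_eq_one.2 (2 * q).reduced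
  · by_contra hlt
    have hden : ((2 * q).den : ℤ) = 1 := by have := (2 * q).den_pos; omega
    rw [hden, Int.cast_one, mul_one] at hnum
    exact hhalf ⟨(2 * q).num, by linarith⟩

variable {u : ℂ}

theorem re_sq_add_im_sq_eq_one (hu : ‖u‖ = 1) : u.re ^ 2 + u.im ^ 2 = 1 := by
  simpa [hu, pow_two, Complex.normSq_apply] using (Complex.sq_norm u).symm

theorem im_ne_zero_of_norm_eq_one (hu : ‖u‖ = 1) (hhalf : ¬ ∃ k : ℤ, u.re = k / 2) :
    u.im ≠ 0 := by
  intro him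
  have hre : u.re ^ 2 = 1 := by simpa [him] using re_sq_add_im_sq_eq_one hu
  rcases sq_eq_one_iff.1 hre with h | h
  · exact hhalf ⟨2, by norm_num [h]⟩
  · exact hhalf ⟨-2, by norm_num [h]⟩

theorem re_pow_add_two_mul (hu : ‖u‖ = 1) (j : ℕ) (ξ : ℂ) :
    (u ^ (j + 2) * ξ).re = 2 * u.re * (u ^ (j + 1) * ξ).re - (u ^ j * ξ).re := by
  simp only [pow_succ', mul_assoc u]
  generalize u ^ j * ξ = η
  simp only [Complex.mul_re, Complex.mul_im]
  linear_combination -η.re * re_sq_add_im_sq_eq_one hu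

theorem abs_im_mul_norm_le (hu : ‖u‖ = 1) (η : ℂ) :
    |u.im| * ‖η‖ ≤ 2 * |η.re| + |(u * η).re| := by
  have hre : |u.re| ≤ 1 := hu ▸ Complex.abs_re_le_norm u
  have him : |u.im| ≤ 1 := hu ▸ Complex.abs_im_le_norm u
  have h : |u.im * η.im| ≤ |u.re * η.re| + |(u * η).re| := by
    rw [Complex.mul_re, ← sub_sub_cancel (u.re * η.re) (u.im * η.im)]
    simpa using abs_sub (u.re * η.re) (u.re * η.re - u.im * η.im)
  rw [abs_mul, abs_mul] at h
  nlinarith [Complex.norm_le_abs_re_add_abs_im η, abs_nonneg η.re, abs_nonneg u.im]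

theorem exists_le_dist_int_re {ε : ℝ} {a b : ℤ} (hu : ‖u‖ = 1) (hab : IsCoprime a b) (hb : 2 ≤ b)
    (hre : 2 * u.re * b = a) (hε : 0 < ε) (hbε : 4 * b * ε < 1) {ξ : ℂ}
    (hξ : 12 * ε < |u.im| * ‖ξ‖) {k : ℕ} (hk : ‖ξ‖ + 1 < 2 ^ k) :
    ∃ j ≤ 2 * k + 1,
      ε ≤ |(u ^ j * ξ).re / Real.pi - round ((u ^ j * ξ).re / Real.pi)| := by
  by_contra! hnear
  have hbR : (2 : ℝ) ≤ b := by exact_mod_cast hb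
  have hbabs : |(b : ℝ)| = b := abs_of_pos (by linarith)
  have habs : |(a : ℝ)| ≤ 2 * b := by
    have hure : |u.re| ≤ 1 := hu ▸ Complex.abs_re_le_norm u
    rw [← hre, abs_mul, abs_mul, hbabs, abs_two]
    nlinarith
  have hsize : ∀ j, |(u ^ j * ξ).re / Real.pi| + ε < |(b : ℝ)| ^ k := by
    intro j
    have hle : |(u ^ j * ξ).re| ≤ ‖ξ‖ := by simpa [hu] using Complex.abs_re_le_norm (u ^ j * ξ)
    have hdiv : |(u ^ j * ξ).re / Real.pi| ≤ ‖ξ‖ := by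
      rw [abs_div, abs_of_pos Real.pi_pos, div_le_iff₀ Real.pi_pos]
      nlinarith [norm_nonneg ξ, Real.pi_gt_three]
    have hpow : (2 : ℝ) ^ k ≤ |(b : ℝ)| ^ k := by rw [hbabs]; gcongr
    nlinarith
  have hsmall : ∀ j, k ≤ j → j + k ≤ 2 * k + 1 → |(u ^ j * ξ).re| ≤ 4 * ε := by
    intro j hkj hjk
    have hzero := round_eq_zero_of_recurrence hab (x := fun j => (u ^ j * ξ).re / Real.pi)
      (by rw [hbabs]; nlinarith)
      (fun j _ => by rw [re_pow_add_two_mul hu, ← hre]; ring)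
      (fun j hj => (hnear j hj).le) hkj hjk (hsize j)
    have h := hnear j (by omega)
    rw [hzero, Int.cast_zero, sub_zero, abs_div, abs_of_pos Real.pi_pos,
      div_lt_iff₀ Real.pi_pos] at h
    nlinarith [Real.pi_le_four]
  have h := abs_im_mul_norm_le hu (u ^ k * ξ)
  rw [← mul_assoc, ← pow_succ', norm_mul, norm_pow, hu, one_pow, one_mul] at h
  linarith [hsmall k le_rfl (by omega), hsmall (k + 1) (by omega) (by omega)]

theorem exists_abs_cos_le (hu : ‖u‖ = 1) (hrat : ∃ q : ℚ, u.re = q)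
    (hhalf : ¬ ∃ k : ℤ, u.re = k / 2) {κ : ℝ} (hκ : 0 < κ) :
    ∃ δ : ℝ, 0 < δ ∧ δ ≤ 1 ∧ ∀ ξ : ℂ, κ ≤ ‖ξ‖ → ∀ k : ℕ, ‖ξ‖ + 1 < 2 ^ k →
      ∃ j ≤ 2 * k + 1, |Real.cos (u ^ j * ξ).re| ≤ 1 - δ := by
  obtain ⟨a, b, hab, hb, hre⟩ := exists_isCoprime_of_rat hrat hhalf
  have him : 0 < |u.im| := abs_pos.2 (im_ne_zero_of_norm_eq_one hu hhalf)
  have hbR : (2 : ℝ) ≤ b := by exact_mod_cast hb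
  obtain ⟨ε, hε, hεmin⟩ := exists_between
    (show 0 < min (1 / (4 * (b : ℝ))) (κ * |u.im| / 12) by positivity)
  have hbε : 4 * b * ε < 1 := by
    have := hεmin.trans_le (min_le_left _ _)
    rwa [lt_div_iff₀ (by positivity), mul_comm] at this
  have hκε : 12 * ε < |u.im| * κ := by linarith [hεmin.trans_le (min_le_right _ _)]
  refine ⟨2 * ε ^ 2, by positivity, by nlinarith, fun ξ hξ k hk => ?_⟩
  obtain ⟨j, hj, hdist⟩ := exists_le_dist_int_re hu hab hb hre hε hbε
    (hκε.trans_le (by gcongr)) hk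
  exact ⟨j, hj, abs_cos_le_of_le_dist_int hε.le hdist⟩

end Rotation

/-- The step probabilities of a random walk on the plane: a rotation by `u`, the same rotation
followed by a translation by `±1` of random sign, the inverse rotation, and a translation by `±1`
of random sign. The walk drifts in the direction of `u`, and it does translate. Both kinds of
measure in `theorem3` are of this form. -/
structure StepWeights where
  rot : ℝ
  rotFlip : ℝ
  back : ℝ
  flip : ℝ
  rot_nonneg : 0 ≤ rot
  rotFlip_nonneg : 0 ≤ rotFlip
  back_nonneg : 0 ≤ back
  flip_nonneg : 0 ≤ flip
  sum_eq_one : rot + rotFlip + back + flip = 1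
  back_lt : back < rot + rotFlip
  flip_pos : 0 < rotFlip + flip

namespace StepWeights

variable (W : StepWeights) (u : ℂ)

/-- The probability that a step translates. -/
def flipProb : ℝ := W.rotFlip + W.flip

/-- The mean number of rotations by `u` in a step. -/
def bias : ℝ := W.rot + W.rotFlip - W.back

/-- The weighted mean of `F` over the neighbours `u ξ`, `u⁻¹ ξ` and `ξ` of a frequency `ξ`, where
each translation by `±1` contributes a factor `γ`. -/
def meanWith (γ : ℝ) (F : ℂ → ℝ) (ξ : ℂ) : ℝ :=
  (W.rot + W.rotFlip * γ) * F (u * ξ) + W.back * F (conj u * ξ) + W.flip * γ * F ξ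

/-- The transfer operator: it takes the characteristic function of the walk after `n` steps to
the one after `n + 1` steps. -/
noncomputable def transfer (F : ℂ → ℝ) (ξ : ℂ) : ℝ := W.meanWith u (Real.cos ξ.re) F ξ

/-- The characteristic function of the walk after `n` steps. -/
noncomputable def char : ℕ → ℂ → ℝ
  | 0 => fun _ => 1
  | n + 1 => W.transfer u (char n)

theorem flipProb_pos : 0 < W.flipProb := W.flip_pos

theorem flipProb_le_one : W.flipProb ≤ 1 := by
  unfold flipProb; linarith [W.sum_eq_one, W.rot_nonneg, W.back_nonneg]

theorem bias_pos : 0 < W.bias := sub_pos.2 W.back_lt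

theorem bias_le_one : W.bias ≤ 1 := by
  unfold bias; linarith [W.sum_eq_one, W.flip_nonneg, W.back_nonneg]

variable {W u}

theorem meanWith_const_mul (γ a : ℝ) (F : ℂ → ℝ) (ξ : ℂ) :
    W.meanWith u γ (fun ζ => a * F ζ) ξ = a * W.meanWith u γ F ξ := by
  unfold meanWith; ring

theorem abs_meanWith_le {F G : ℂ → ℝ} {ξ : ℂ} {γ γ' : ℝ} (hγ : |γ| ≤ γ')
    (hu : |F (u * ξ)| ≤ G (u * ξ)) (hconj : |F (conj u * ξ)| ≤ G (conj u * ξ))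
    (hξ : |F ξ| ≤ G ξ) : |W.meanWith u γ F ξ| ≤ W.meanWith u γ' G ξ := by
  have hrot := W.rot_nonneg
  have hrotFlip := W.rotFlip_nonneg
  have hback := W.back_nonneg
  have hflip := W.flip_nonneg
  have hγ' : 0 ≤ γ' := (abs_nonneg _).trans hγ
  have hcoef : |W.rot + W.rotFlip * γ| ≤ W.rot + W.rotFlip * γ' := by
    refine (abs_add_le _ _).trans ?_
    rw [abs_of_nonneg hrot, abs_mul, abs_of_nonneg hrotFlip]
    gcongr
  refine (abs_add_three _ _ _).trans ?_
  simp only [abs_mul, abs_of_nonneg hback, abs_of_nonneg hflip]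
  unfold meanWith
  gcongr

section HighFrequency

variable {R δ : ℝ} {L : ℕ}

theorem abs_char_le_of_supersolution (hu : ‖u‖ = 1) {w : ℂ → ℝ} {lam : ℝ}
    (hw : ∀ ξ : ℂ, ‖ξ‖ = R → 1 ≤ w ξ) (hlam : 0 ≤ lam)
    (hstep : ∀ ξ : ℂ, ‖ξ‖ = R →
      ∃ γ, |Real.cos ξ.re| ≤ γ ∧ W.meanWith u γ w ξ ≤ lam * w ξ)
    (n : ℕ) : ∀ ξ : ℂ, ‖ξ‖ = R → |W.char u n ξ| ≤ lam ^ n * w ξ := by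
  induction n with
  | zero => simpa [char] using hw
  | succ n ih =>
    intro ξ hξ
    obtain ⟨γ, hγ, hle⟩ := hstep ξ hξ
    calc |W.char u (n + 1) ξ| ≤ W.meanWith u γ (fun ζ => lam ^ n * w ζ) ξ :=
          abs_meanWith_le hγ (ih _ (by simp [hu, hξ])) (ih _ (by simp [hu, hξ])) (ih _ hξ)
      _ = lam ^ n * W.meanWith u γ w ξ := meanWith_const_mul _ _ _ _
      _ ≤ lam ^ n * (lam * w ξ) := by gcongr
      _ = lam ^ (n + 1) * w ξ := by ring

theorem meanWith_one_sub_le {w : ℂ → ℝ} {ξ : ℂ} {s : ℝ} (hδ : 0 ≤ δ) (hδ1 : δ ≤ 1) (hs : 0 ≤ s)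
    (hu : w (u * ξ) ≤ w ξ + s) (hconj : w (conj u * ξ) ≤ w ξ + s) :
    W.meanWith u (1 - δ) w ξ ≤ (1 - δ * W.flipProb) * w ξ + s := by
  have hrotFlip := W.rotFlip_nonneg
  have hback := W.back_nonneg
  have hflip := W.flip_nonneg
  have hrot : 0 ≤ W.rot + W.rotFlip * (1 - δ) :=
    add_nonneg W.rot_nonneg (mul_nonneg hrotFlip (by linarith))
  have hle : W.rot + W.rotFlip * (1 - δ) + W.back ≤ 1 := by
    nlinarith [W.sum_eq_one, mul_nonneg hrotFlip hδ]
  calc W.meanWith u (1 - δ) w ξ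
      ≤ (W.rot + W.rotFlip * (1 - δ)) * (w ξ + s) + W.back * (w ξ + s)
          + W.flip * (1 - δ) * w ξ := by unfold meanWith; gcongr
    _ = (1 - δ * W.flipProb) * w ξ + (W.rot + W.rotFlip * (1 - δ) + W.back) * s := by
        unfold flipProb; linear_combination w ξ * W.sum_eq_one
    _ ≤ (1 - δ * W.flipProb) * w ξ + s := by gcongr; exact mul_le_of_le_one_left hs hle

theorem meanWith_one_le {w : ℂ → ℝ} {ξ : ℂ} {s : ℝ} (hu : w (u * ξ) ≤ w ξ - s)
    (hconj : w (conj u * ξ) ≤ w ξ + s) : W.meanWith u 1 w ξ ≤ w ξ - s * W.bias := by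
  have hrotFlip := W.rotFlip_nonneg
  have hback := W.back_nonneg
  have hrot := W.rot_nonneg
  calc W.meanWith u 1 w ξ
      ≤ (W.rot + W.rotFlip * 1) * (w ξ - s) + W.back * (w ξ + s) + W.flip * 1 * w ξ := by
        unfold meanWith; gcongr
    _ = w ξ - s * W.bias := by unfold bias; linear_combination w ξ * W.sum_eq_one

variable (u δ) in
/-- The number of rotations by `u` that bring the frequency `ξ` to one where the cosine is bounded
away from `±1`; it is `0` if there is no such number. -/
noncomputable def hittingTime (ξ : ℂ) : ℕ := sInf {j | |Real.cos (u ^ j * ξ).re| ≤ 1 - δ}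

variable {ξ : ℂ}

theorem hittingTime_le {j : ℕ} (hj : |Real.cos (u ^ j * ξ).re| ≤ 1 - δ) :
    hittingTime u δ ξ ≤ j := Nat.sInf_le hj

theorem abs_cos_hittingTime_le (h : ∃ j, |Real.cos (u ^ j * ξ).re| ≤ 1 - δ) :
    |Real.cos (u ^ hittingTime u δ ξ * ξ).re| ≤ 1 - δ := Nat.sInf_mem h

theorem hittingTime_conj_mul_le (hu : ‖u‖ = 1)
    (h : ∃ j, |Real.cos (u ^ j * ξ).re| ≤ 1 - δ) :
    hittingTime u δ (conj u * ξ) ≤ hittingTime u δ ξ + 1 := by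
  have hrot : u ^ (hittingTime u δ ξ + 1) * (conj u * ξ) = u ^ hittingTime u δ ξ * ξ := by
    have hconj : u * conj u = 1 := by simp [Complex.mul_conj', hu]
    linear_combination u ^ hittingTime u δ ξ * ξ * hconj
  exact hittingTime_le (hrot ▸ abs_cos_hittingTime_le h)

theorem hittingTime_mul_add_one_le (h : ∃ j, |Real.cos (u ^ j * ξ).re| ≤ 1 - δ)
    (hξ : ¬ |Real.cos ξ.re| ≤ 1 - δ) : hittingTime u δ (u * ξ) + 1 ≤ hittingTime u δ ξ := by
  have hmem := abs_cos_hittingTime_le h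
  generalize hittingTime u δ ξ = d at hmem
  cases d with
  | zero => simp only [pow_zero, one_mul] at hmem; exact absurd hmem hξ
  | succ m =>
    rw [pow_succ, mul_assoc] at hmem
    exact Nat.succ_le_succ (hittingTime_le hmem)

variable (u δ) in
/-- The Lyapunov function of the walk on the frequencies `u ^ j * ξ`, affine in the hitting time. -/
noncomputable def lyapunov (s : ℝ) (ξ : ℂ) : ℝ := 1 + s * hittingTime u δ ξ

variable {s : ℝ}

theorem lyapunov_le (hs : 0 ≤ s) (h : ∃ j ≤ L, |Real.cos (u ^ j * ξ).re| ≤ 1 - δ) :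
    lyapunov u δ s ξ ≤ 1 + s * L := by
  obtain ⟨j, hjL, hj⟩ := h
  unfold lyapunov
  gcongr
  exact (hittingTime_le hj).trans hjL

theorem lyapunov_conj_mul_le (hu : ‖u‖ = 1) (hs : 0 ≤ s)
    (h : ∃ j, |Real.cos (u ^ j * ξ).re| ≤ 1 - δ) :
    lyapunov u δ s (conj u * ξ) ≤ lyapunov u δ s ξ + s := by
  have hle : (hittingTime u δ (conj u * ξ) : ℝ) ≤ hittingTime u δ ξ + 1 := by
    exact_mod_cast hittingTime_conj_mul_le hu h
  unfold lyapunov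
  linarith [mul_le_mul_of_nonneg_left hle hs]

theorem lyapunov_mul_le (hs : 0 ≤ s) (h : ∃ j, |Real.cos (u ^ j * ξ).re| ≤ 1 - δ)
    (hξ : ¬ |Real.cos ξ.re| ≤ 1 - δ) : lyapunov u δ s (u * ξ) ≤ lyapunov u δ s ξ - s := by
  have hle : (hittingTime u δ (u * ξ) : ℝ) + 1 ≤ hittingTime u δ ξ := by
    exact_mod_cast hittingTime_mul_add_one_le h hξ
  unfold lyapunov
  linarith [mul_le_mul_of_nonneg_left hle hs]

theorem exists_meanWith_lyapunov_le (hu : ‖u‖ = 1) (hδ : 0 < δ) (hδ1 : δ ≤ 1)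
    (hgap : ∀ ξ : ℂ, ‖ξ‖ = R → ∃ j ≤ L, |Real.cos (u ^ j * ξ).re| ≤ 1 - δ) (hs : 0 ≤ s)
    (hsL : s * (L + 1) = δ * W.flipProb / 2) (hξ : ‖ξ‖ = R) :
    ∃ γ, |Real.cos ξ.re| ≤ γ ∧
      W.meanWith u γ (lyapunov u δ s) ξ ≤ (1 - s * W.bias / 2) * lyapunov u δ s ξ := by
  have hex : ∃ j, |Real.cos (u ^ j * ξ).re| ≤ 1 - δ := (hgap ξ hξ).imp fun _ => And.right
  have hconj := lyapunov_conj_mul_le hu hs hex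
  have hbias := mul_nonneg hs W.bias_pos.le
  have hsL0 : 0 ≤ s * L := by positivity
  by_cases hcos : |Real.cos ξ.re| ≤ 1 - δ
  · have hone : lyapunov u δ s ξ = 1 := by
      simp [lyapunov, Nat.le_zero.1 (hittingTime_le (j := 0) (by simpa using hcos))]
    have hmul : lyapunov u δ s (u * ξ) ≤ 1 + s * L := lyapunov_le hs (hgap _ (by simp [hu, hξ]))
    refine ⟨1 - δ, hcos, (meanWith_one_sub_le (s := s * (L + 1)) hδ.le hδ1 (by positivity)
      (by linarith) (by linarith)).trans ?_⟩
    rw [hone]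
    nlinarith [W.bias_le_one]
  · refine ⟨1, Real.abs_cos_le_one _,
      (meanWith_one_le (lyapunov_mul_le hs hex hcos) hconj).trans ?_⟩
    have hle : lyapunov u δ s ξ ≤ 2 := by
      nlinarith [lyapunov_le hs (hgap ξ hξ), mul_le_one₀ hδ1 W.flipProb_pos.le W.flipProb_le_one]
    nlinarith

theorem abs_char_le_of_gap (hu : ‖u‖ = 1) (hδ : 0 < δ) (hδ1 : δ ≤ 1)
    (hgap : ∀ ξ : ℂ, ‖ξ‖ = R → ∃ j ≤ L, |Real.cos (u ^ j * ξ).re| ≤ 1 - δ)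
    (n : ℕ) (hξ : ‖ξ‖ = R) :
    |W.char u n ξ| ≤ 2 * (1 - δ * W.flipProb * W.bias / 4 / (L + 1)) ^ n := by
  have hflip := W.flipProb_pos
  have hprod := mul_le_one₀ hδ1 hflip.le W.flipProb_le_one
  obtain ⟨s, hs, hsL⟩ : ∃ s : ℝ, 0 < s ∧ s * (L + 1) = δ * W.flipProb / 2 :=
    ⟨δ * W.flipProb / 2 / (L + 1), by positivity, by field_simp⟩
  have hsL0 : 0 ≤ s * L := by positivity
  have hrate : 1 - δ * W.flipProb * W.bias / 4 / (L + 1) = 1 - s * W.bias / 2 := by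
    field_simp
    linear_combination 4 * W.bias * hsL
  have hlam : 0 ≤ 1 - s * W.bias / 2 := by nlinarith [W.bias_le_one, W.bias_pos]
  rw [hrate]
  calc |W.char u n ξ| ≤ (1 - s * W.bias / 2) ^ n * lyapunov u δ s ξ :=
        abs_char_le_of_supersolution hu
          (fun ξ _ => le_add_of_nonneg_right (mul_nonneg hs.le (Nat.cast_nonneg _))) hlam
          (fun ξ hξ => exists_meanWith_lyapunov_le hu hδ hδ1 hgap hs.le hsL hξ) n ξ hξ
    _ ≤ (1 - s * W.bias / 2) ^ n * 2 := by
        gcongr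
        linarith [lyapunov_le hs.le (hgap ξ hξ)]
    _ = 2 * (1 - s * W.bias / 2) ^ n := mul_comm _ _

end HighFrequency

end StepWeights

theorem one_sub_pow_le_exp {a : ℝ} (ha : a ≤ 1) (n : ℕ) : (1 - a) ^ n ≤ Real.exp (-(a * n)) := by
  rw [← neg_mul, mul_comm, Real.exp_nat_mul]
  exact pow_le_pow_left₀ (sub_nonneg.2 ha) (Real.one_sub_le_exp_neg a) n

theorem two_mul_sqrt_mul_sqrt_le {A B K x : ℝ} (hA : 0 ≤ A) (hB : 0 ≤ B) (hK : 0 < K)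
    (hx : 0 ≤ x) : 2 * √(A * B) * √x ≤ A / K * x + K * B := by
  have hprod : √(A / K * x) * √(K * B) = √(A * B) * √x := by
    rw [← Real.sqrt_mul (by positivity), ← Real.sqrt_mul (by positivity)]
    congr 1; field_simp
  have hsq := sq_nonneg (√(A / K * x) - √(K * B))
  rw [sub_sq, Real.sq_sqrt (by positivity), Real.sq_sqrt (by positivity), mul_assoc 2, hprod] at hsq
  linarith

namespace StepWeights

/-- Since `A n / k + k log 2` is at least of order `√n`, the decay at rate `1 / k` with
`2 ^ k ≈ ‖ξ‖` is uniform in `ξ` up to a linear factor. -/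
theorem exists_abs_char_le (W : StepWeights) {u : ℂ} (hu : ‖u‖ = 1) (hrat : ∃ q : ℚ, u.re = q)
    (hhalf : ¬ ∃ k : ℤ, u.re = k / 2) {κ : ℝ} (hκ : 0 < κ) :
    ∃ c : ℝ, 0 < c ∧ ∀ (n : ℕ) (ξ : ℂ), κ ≤ ‖ξ‖ →
      |W.char u n ξ| ≤ 8 * (‖ξ‖ + 1) * Real.exp (-c * √n) := by
  obtain ⟨δ, hδ, hδ1, hgap⟩ := exists_abs_cos_le hu hrat hhalf hκ
  have hflip := W.flipProb_pos
  have hbias := W.bias_pos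
  have hlog : 0 < Real.log 2 := Real.log_pos one_lt_two
  set A := δ * W.flipProb * W.bias / 4
  have hA : 0 < A := by positivity
  have hA1 : A ≤ 1 := by
    have : δ * W.flipProb * W.bias ≤ 1 :=
      mul_le_one₀ (mul_le_one₀ hδ1 hflip.le W.flipProb_le_one) hbias.le W.bias_le_one
    simp only [A]; linarith
  refine ⟨2 * √(A * (Real.log 2 / 2)), by positivity, fun n ξ hξ => ?_⟩
  obtain ⟨m, hm, hm'⟩ := exists_nat_pow_near (le_add_of_nonneg_left (norm_nonneg ξ)) one_lt_two
  set K : ℝ := ((2 * (m + 1) + 1 : ℕ) : ℝ) + 1 with hK_def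
  have hK : K = 2 * (m + 2 : ℕ) := by rw [hK_def]; push_cast; ring
  have hK1 : 1 ≤ K := by rw [hK_def]; linarith [Nat.cast_nonneg (α := ℝ) (2 * (m + 1) + 1)]
  calc |W.char u n ξ| ≤ 2 * (1 - A / K) ^ n :=
        abs_char_le_of_gap hu hδ hδ1 (R := ‖ξ‖)
          (fun ζ hζ => hgap ζ (hζ ▸ hξ) (m + 1) (hζ ▸ hm')) n rfl
    _ ≤ 2 * Real.exp (-(A / K * n)) := by
        gcongr; exact one_sub_pow_le_exp ((div_le_one (by positivity)).2 (hA1.trans hK1)) n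
    _ ≤ 2 * Real.exp (-(2 * √(A * (Real.log 2 / 2)) * √n) + K * (Real.log 2 / 2)) := by
        gcongr
        linarith [two_mul_sqrt_mul_sqrt_le hA.le (half_pos hlog).le (by positivity : 0 < K)
          n.cast_nonneg]
    _ = 8 * 2 ^ m * Real.exp (-(2 * √(A * (Real.log 2 / 2))) * √n) := by
        rw [Real.exp_add, hK, mul_comm 2 ((m + 2 : ℕ) : ℝ), mul_assoc ((m + 2 : ℕ) : ℝ),
          mul_div_cancel₀ _ two_ne_zero, Real.exp_nat_mul, Real.exp_log two_pos, neg_mul]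
        ring
    _ ≤ 8 * (‖ξ‖ + 1) * Real.exp (-(2 * √(A * (Real.log 2 / 2))) * √n) := by gcongr

end StepWeights

theorem abs_re_mul_sq_le (C ζ : ℂ) : |(C * ζ ^ 2).re| ≤ ‖C‖ * ‖ζ‖ ^ 2 :=
  (Complex.abs_re_le_norm _).trans (by rw [norm_mul, norm_pow])

theorem abs_one_sub_cos_sub_le {x : ℝ} (hx : |x| ≤ 1) :
    |1 - Real.cos x - x ^ 2 / 2| ≤ (x ^ 2) ^ 2 := by
  have h := Real.cos_bound hx
  rw [abs_sub_comm, show 1 - x ^ 2 / 2 - Real.cos x = 1 - Real.cos x - x ^ 2 / 2 by ring] at h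
  have h4 : |x| ^ 4 = (x ^ 2) ^ 2 := by rw [← sq_abs x]; ring
  nlinarith [sq_nonneg (x ^ 2)]

theorem abs_exp_neg_sub_one_add_le {x : ℝ} (hx : 0 ≤ x) (hx1 : x ≤ 1) :
    |Real.exp (-x) - 1 + x| ≤ x ^ 2 := by
  simpa using Real.abs_exp_sub_one_sub_id_le (x := -x) (by rwa [abs_neg, abs_of_nonneg hx])

theorem exp_neg_mul_add_le {q t K w : ℝ} (hqt0 : 0 ≤ q * t) (hqt : q * t ≤ 1 / 4)
    (hKt : K * t ≤ q / 8) (ht : 0 ≤ t) (hw : 1 / 2 ≤ w) :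
    Real.exp (-(q * t)) * w + K * t ^ 2 ≤ Real.exp (-(q * t / 2)) * w := by
  set e := Real.exp (-(q * t / 2)) with he
  have hsq : Real.exp (-(q * t)) = e ^ 2 := by
    rw [he, ← Real.exp_nat_mul]; congr 1; push_cast; ring
  have he1 : 1 - q * t / 2 ≤ e := Real.one_sub_le_exp_neg _
  have hinv : q * t / 2 * e ≤ 1 - e := by
    have h := mul_le_mul_of_nonneg_right (Real.add_one_le_exp (q * t / 2)) (Real.exp_pos _).le
      (a := Real.exp (-(q * t / 2)))
    rw [← Real.exp_add, add_neg_cancel, Real.exp_zero] at h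
    linarith
  have hgap : q * t / 4 ≤ e - e ^ 2 := by nlinarith [Real.exp_pos (-(q * t / 2))]
  rw [hsq]
  nlinarith

theorem linear_add_sq_mul_exp_le {q x : ℝ} (hq : 0 < q) (hx : 0 ≤ x) :
    (x + x ^ 2) * Real.exp (-(q * x)) ≤ (1 / q + 2 / q ^ 2) := by
  have hlin : q * x ≤ Real.exp (q * x) := by linarith [Real.add_one_le_exp (q * x)]
  have hsq : (q * x) ^ 2 / 2 ≤ Real.exp (q * x) :=
    Real.pow_div_factorial_le_exp (q * x) (by positivity) 2
  have hbound : x + x ^ 2 ≤ (1 / q + 2 / q ^ 2) * Real.exp (q * x) := by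
    calc x + x ^ 2 = 1 / q * (q * x) + 2 / q ^ 2 * ((q * x) ^ 2 / 2) := by field_simp
      _ ≤ 1 / q * Real.exp (q * x) + 2 / q ^ 2 * Real.exp (q * x) := by
          gcongr
      _ = _ := by ring
  rwa [Real.exp_neg, ← div_eq_mul_inv, div_le_iff₀ (Real.exp_pos _)]

namespace StepWeights

/-- Half the variance of a step in each coordinate, averaged over all directions: the Gaussian
approximation of `W.char u n ξ` is `exp (-(n * W.halfVar * ‖ξ‖ ^ 2))`. -/
noncomputable def halfVar (W : StepWeights) : ℝ := W.flipProb / 4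

theorem halfVar_pos (W : StepWeights) : 0 < W.halfVar := div_pos W.flipProb_pos four_pos

theorem halfVar_le (W : StepWeights) : W.halfVar ≤ 1 / 4 :=
  div_le_div_of_nonneg_right W.flipProb_le_one zero_le_four

section LowFrequency

variable {W : StepWeights} {u : ℂ}

/-- The averaging operator multiplies `ζ ^ 2` by `Λ ≠ 1`, so the quadratic defect of the Gaussian
can be absorbed by a multiple of `ζ ^ 2`. -/
theorem exists_corrector (hu : ‖u‖ = 1) (him : u.im ≠ 0) :
    ∃ C : ℂ, ∀ ξ : ℂ, W.meanWith u 1 (fun ζ => (C * ζ ^ 2).re) ξ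
      = (C * ξ ^ 2).re + W.halfVar * (ξ ^ 2).re := by
  set Λ : ℂ := (W.rot + W.rotFlip : ℝ) * u ^ 2 + W.back * conj u ^ 2 + W.flip with hΛ
  have hΛ1 : Λ - 1 ≠ 0 := by
    intro h
    have hre : (W.rot + W.rotFlip + W.back) * u.im ^ 2 = 0 := by
      have h0 := congrArg Complex.re h
      simp [hΛ, pow_two] at h0
      linear_combination (-1 / 2) * h0 + (W.sum_eq_one) / 2 +
        (W.rot + W.rotFlip + W.back) / 2 * re_sq_add_im_sq_eq_one hu
    have hpos : 0 < W.rot + W.rotFlip + W.back := by linarith [W.back_lt, W.back_nonneg]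
    exact him (by simpa [hpos.ne'] using hre)
  refine ⟨W.halfVar / (Λ - 1), fun ξ => ?_⟩
  set C : ℂ := W.halfVar / (Λ - 1)
  have hC : C * (Λ - 1) = W.halfVar := div_mul_cancel₀ _ hΛ1
  simp only [meanWith, mul_one, ← Complex.re_ofReal_mul, ← Complex.add_re]
  congr 1
  linear_combination ξ ^ 2 * hC

theorem abs_rotFlip_mul_add_flip_mul_le {a b M : ℝ} (ha : |a| ≤ M) (hb : |b| ≤ M) :
    |W.rotFlip * a + W.flip * b| ≤ M :=
  calc |W.rotFlip * a + W.flip * b| ≤ W.rotFlip * |a| + W.flip * |b| := by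
        simpa only [abs_mul, abs_of_nonneg W.rotFlip_nonneg, abs_of_nonneg W.flip_nonneg]
          using abs_add_le (W.rotFlip * a) (W.flip * b)
    _ ≤ W.rotFlip * M + W.flip * M := add_le_add
        (mul_le_mul_of_nonneg_left ha W.rotFlip_nonneg) (mul_le_mul_of_nonneg_left hb W.flip_nonneg)
    _ = W.flipProb * M := by unfold flipProb; ring
    _ ≤ M := mul_le_of_le_one_left ((abs_nonneg a).trans ha) W.flipProb_le_one

theorem transfer_one_add_sub_eq {C : ℂ}
    (hC : ∀ ξ : ℂ, W.meanWith u 1 (fun ζ => (C * ζ ^ 2).re) ξ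
      = (C * ξ ^ 2).re + W.halfVar * (ξ ^ 2).re) (g : ℝ) (ξ : ℂ) :
    W.transfer u (fun ζ => 1 + (C * ζ ^ 2).re) ξ - g * (1 + (C * ξ ^ 2).re)
      = W.halfVar * ‖ξ‖ ^ 2 * (C * ξ ^ 2).re
        - 4 * W.halfVar * (1 - Real.cos ξ.re - ξ.re ^ 2 / 2)
        - (1 - Real.cos ξ.re) * (W.rotFlip * (C * (u * ξ) ^ 2).re + W.flip * (C * ξ ^ 2).re)
        - (g - 1 + W.halfVar * ‖ξ‖ ^ 2) * (1 + (C * ξ ^ 2).re) := by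
  have hnorm : ‖ξ‖ ^ 2 = ξ.re ^ 2 + ξ.im ^ 2 := by rw [Complex.sq_norm, Complex.normSq_apply]; ring
  have hsq : (ξ ^ 2).re = ξ.re ^ 2 - ξ.im ^ 2 := by rw [pow_two, Complex.mul_re]; ring
  have hflip : W.rotFlip + W.flip = 4 * W.halfVar := by unfold halfVar flipProb; ring
  have hcorr := hC ξ
  simp only [transfer, meanWith] at hcorr ⊢
  rw [hsq] at hcorr
  rw [hnorm]
  linear_combination hcorr + W.sum_eq_one - (1 - Real.cos ξ.re) * hflip

theorem abs_transfer_sub_le {C : ℂ}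
    (hC : ∀ ξ : ℂ, W.meanWith u 1 (fun ζ => (C * ζ ^ 2).re) ξ
      = (C * ξ ^ 2).re + W.halfVar * (ξ ^ 2).re) (hu : ‖u‖ = 1) {ξ : ℂ} (hξ : ‖ξ‖ ≤ 1) :
    |W.transfer u (fun ζ => 1 + (C * ζ ^ 2).re) ξ
        - Real.exp (-(W.halfVar * ‖ξ‖ ^ 2)) * (1 + (C * ξ ^ 2).re)|
      ≤ 2 * (1 + ‖C‖) * (‖ξ‖ ^ 2) ^ 2 := by
  have hq := W.halfVar_pos
  have hq4 := W.halfVar_le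
  have hre : |ξ.re| ≤ 1 := (Complex.abs_re_le_norm ξ).trans hξ
  have hre_sq : ξ.re ^ 2 ≤ ‖ξ‖ ^ 2 := sq_le_sq.2 (by simpa using Complex.abs_re_le_norm ξ)
  have hcos : 0 ≤ 1 - Real.cos ξ.re := sub_nonneg.2 (Real.cos_le_one _)
  have hcos' : 1 - Real.cos ξ.re ≤ ‖ξ‖ ^ 2 / 2 := by
    linarith [Real.one_sub_sq_div_two_le_cos (x := ξ.re)]
  have hH : |(C * ξ ^ 2).re| ≤ ‖C‖ * ‖ξ‖ ^ 2 := abs_re_mul_sq_le C ξ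
  have hHu : |(C * (u * ξ) ^ 2).re| ≤ ‖C‖ * ‖ξ‖ ^ 2 := by
    simpa [hu] using abs_re_mul_sq_le C (u * ξ)
  have ht1 : ‖ξ‖ ^ 2 ≤ 1 := pow_le_one₀ (norm_nonneg _) hξ
  have ht0 : 0 ≤ ‖ξ‖ ^ 2 := by positivity
  rw [transfer_one_add_sub_eq hC]
  generalize ‖ξ‖ ^ 2 = t at *
  have hquad : |W.halfVar * t * (C * ξ ^ 2).re| ≤ 1 / 4 * t * (‖C‖ * t) := by
    rw [abs_mul, abs_of_nonneg (by positivity)]; gcongr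
  have hTaylor : |4 * W.halfVar * (1 - Real.cos ξ.re - ξ.re ^ 2 / 2)| ≤ 4 * (1 / 4) * t ^ 2 := by
    rw [abs_mul, abs_of_pos (by positivity)]
    gcongr
    exact (abs_one_sub_cos_sub_le hre).trans (by gcongr)
  have hflipped : |(1 - Real.cos ξ.re) * (W.rotFlip * (C * (u * ξ) ^ 2).re
      + W.flip * (C * ξ ^ 2).re)| ≤ t / 2 * (‖C‖ * t) := by
    rw [abs_mul, abs_of_nonneg hcos]
    gcongr
    exact abs_rotFlip_mul_add_flip_mul_le hHu hH
  have hexp : |(Real.exp (-(W.halfVar * t)) - 1 + W.halfVar * t) * (1 + (C * ξ ^ 2).re)|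
      ≤ (1 / 4 * t) ^ 2 * (1 + ‖C‖) := by
    have hqt : W.halfVar * t ≤ 1 / 4 * t := by gcongr
    have hle := (abs_exp_neg_sub_one_add_le (by positivity) (by linarith)).trans
      (pow_le_pow_left₀ (by positivity) hqt 2)
    rw [abs_mul]
    gcongr
    refine (abs_add_le _ _).trans ?_
    rw [abs_one]
    gcongr
    exact hH.trans (mul_le_of_le_one_right (norm_nonneg C) ht1)
  rw [abs_le] at *
  constructor <;> nlinarith [(by positivity : 0 ≤ ‖C‖ * t ^ 2)]

theorem abs_char_sub_le_of_approx {R : ℝ} (hu : ‖u‖ = 1) {w : ℂ → ℝ} {a e B D : ℝ}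
    (ha : 0 ≤ a) (hae : a ≤ e) (hB : 0 ≤ B) (hD : 0 ≤ D)
    (hone : ∀ ξ : ℂ, ‖ξ‖ = R → |1 - w ξ| ≤ B * w ξ)
    (hsuper : ∀ ξ : ℂ, ‖ξ‖ = R → W.meanWith u |Real.cos ξ.re| w ξ ≤ e * w ξ)
    (happrox : ∀ ξ : ℂ, ‖ξ‖ = R → |W.transfer u w ξ - a * w ξ| ≤ D * (e * w ξ)) (n : ℕ) :
    ∀ ξ : ℂ, ‖ξ‖ = R → |W.char u n ξ - a ^ n * w ξ| ≤ (B + n * D) * e ^ n * w ξ := by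
  induction n with
  | zero => simpa [char] using hone
  | succ n ih =>
    intro ξ hξ
    set b := (B + n * D) * e ^ n with hb
    have he : 0 ≤ e := ha.trans hae
    have hsplit : W.char u (n + 1) ξ - a ^ (n + 1) * w ξ
        = W.transfer u (fun ζ => W.char u n ζ - a ^ n * w ζ) ξ
          + a ^ n * (W.transfer u w ξ - a * w ξ) := by
      simp only [char, transfer, meanWith]; ring
    have hmean : |W.transfer u (fun ζ => W.char u n ζ - a ^ n * w ζ) ξ| ≤ b * (e * w ξ) :=
      calc _ ≤ W.meanWith u |Real.cos ξ.re| (fun ζ => b * w ζ) ξ :=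
            abs_meanWith_le le_rfl (ih _ (by simp [hu, hξ])) (ih _ (by simp [hu, hξ])) (ih _ hξ)
        _ = b * W.meanWith u |Real.cos ξ.re| w ξ := meanWith_const_mul _ _ _ _
        _ ≤ b * (e * w ξ) := by gcongr; exact hsuper ξ hξ
    calc |W.char u (n + 1) ξ - a ^ (n + 1) * w ξ|
        ≤ b * (e * w ξ) + a ^ n * |W.transfer u w ξ - a * w ξ| := by
          rw [hsplit]
          refine (abs_add_le _ _).trans (add_le_add hmean ?_)
          rw [abs_mul, abs_of_nonneg (pow_nonneg ha n)]
      _ ≤ b * (e * w ξ) + e ^ n * (D * (e * w ξ)) := by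
          gcongr
          exact happrox ξ hξ
      _ = (B + (n + 1 : ℕ) * D) * e ^ (n + 1) * w ξ := by rw [hb]; push_cast; ring

section

variable {C ξ : ℂ} (hξ : 2 * (1 + ‖C‖) * ‖ξ‖ ^ 2 ≤ W.halfVar / 8)
include hξ

theorem norm_le_one_of_mul_sq_le : ‖ξ‖ ≤ 1 := by
  rw [← sq_le_one_iff₀ (norm_nonneg _)]
  nlinarith [W.halfVar_le, mul_nonneg (norm_nonneg C) (sq_nonneg ‖ξ‖)]

theorem abs_re_mul_sq_le_of_mul_sq_le : |(C * ξ ^ 2).re| ≤ 1 / 4 := by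
  nlinarith [abs_re_mul_sq_le C ξ, W.halfVar_le, sq_nonneg ‖ξ‖]

theorem meanWith_abs_cos_eq_transfer (F : ℂ → ℝ) :
    W.meanWith u |Real.cos ξ.re| F ξ = W.transfer u F ξ := by
  have hre := abs_le.1 ((Complex.abs_re_le_norm ξ).trans (norm_le_one_of_mul_sq_le hξ))
  rw [transfer, abs_of_nonneg (Real.cos_nonneg_of_mem_Icc
    ⟨by linarith [Real.pi_gt_three], by linarith [Real.pi_gt_three]⟩)]

theorem transfer_one_add_le (hu : ‖u‖ = 1)
    (hC : ∀ ξ : ℂ, W.meanWith u 1 (fun ζ => (C * ζ ^ 2).re) ξ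
      = (C * ξ ^ 2).re + W.halfVar * (ξ ^ 2).re) :
    W.transfer u (fun ζ => 1 + (C * ζ ^ 2).re) ξ
      ≤ Real.exp (-(W.halfVar * ‖ξ‖ ^ 2 / 2)) * (1 + (C * ξ ^ 2).re) := by
  have hq := W.halfVar_pos
  have hle := (abs_le.1 (abs_transfer_sub_le hC hu (norm_le_one_of_mul_sq_le hξ))).2
  have hqt : W.halfVar * ‖ξ‖ ^ 2 ≤ 1 / 4 * 1 ^ 2 := by
    gcongr
    exacts [W.halfVar_le, norm_le_one_of_mul_sq_le hξ]
  have habs := abs_le.1 (abs_re_mul_sq_le_of_mul_sq_le hξ)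
  linarith [exp_neg_mul_add_le (w := 1 + (C * ξ ^ 2).re) (by positivity)
    (hqt.trans_eq (by norm_num)) hξ (sq_nonneg _) (by linarith)]

/-- On a small circle `w = 1 + (C ζ ^ 2).re` is both an approximate eigenfunction with eigenvalue
`exp (-q ‖ξ‖ ^ 2)` and a supersolution with the larger factor `exp (-q ‖ξ‖ ^ 2 / 2)`, so the errors
of the individual steps decay geometrically. -/
theorem abs_char_sub_exp_pow_mul_le (hu : ‖u‖ = 1)
    (hC : ∀ ξ : ℂ, W.meanWith u 1 (fun ζ => (C * ζ ^ 2).re) ξ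
      = (C * ξ ^ 2).re + W.halfVar * (ξ ^ 2).re) (n : ℕ) :
    |W.char u n ξ - Real.exp (-(W.halfVar * ‖ξ‖ ^ 2)) ^ n * (1 + (C * ξ ^ 2).re)|
      ≤ 4 * (1 + ‖C‖) * (‖ξ‖ ^ 2 + 2 * n * (‖ξ‖ ^ 2) ^ 2)
        * Real.exp (-(W.halfVar * ‖ξ‖ ^ 2 / 2)) ^ n := by
  set t := ‖ξ‖ ^ 2 with ht
  set K := 2 * (1 + ‖C‖) with hK
  have ht0 : 0 ≤ t := by positivity
  have hqt : 0 ≤ W.halfVar * t := mul_nonneg W.halfVar_pos.le ht0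
  have hqt1 : W.halfVar * t ≤ 1 / 4 * 1 := mul_le_mul W.halfVar_le
    (pow_le_one₀ (norm_nonneg _) (norm_le_one_of_mul_sq_le hξ)) ht0 (by norm_num)
  have hsmall : ∀ ζ : ℂ, ‖ζ‖ = ‖ξ‖ → 2 * (1 + ‖C‖) * ‖ζ‖ ^ 2 ≤ W.halfVar / 8 := fun ζ hζ => by
    rw [hζ]; exact hξ
  have hw : ∀ ζ : ℂ, ‖ζ‖ = ‖ξ‖ → |(C * ζ ^ 2).re| ≤ 1 / 4 := fun ζ hζ =>
    abs_re_mul_sq_le_of_mul_sq_le (hsmall ζ hζ)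
  have hexp : 7 / 8 ≤ Real.exp (-(W.halfVar * t / 2)) := by
    linarith [Real.one_sub_le_exp_neg (W.halfVar * t / 2)]
  have hmain := abs_char_sub_le_of_approx (W := W) hu (w := fun ζ => 1 + (C * ζ ^ 2).re) (R := ‖ξ‖)
    (a := Real.exp (-(W.halfVar * t))) (e := Real.exp (-(W.halfVar * t / 2)))
    (B := K * t) (D := 2 * (K * t ^ 2)) (Real.exp_pos _).le
    (Real.exp_le_exp.2 (by linarith)) (by positivity) (by positivity)
    (fun ζ hζ => ?_) (fun ζ hζ => ?_) (fun ζ hζ => ?_) n ξ rfl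
  · have hle : 1 + (C * ξ ^ 2).re ≤ 2 := by linarith [abs_le.1 (hw ξ rfl)]
    refine hmain.trans ((mul_le_mul_of_nonneg_left hle (by positivity)).trans_eq ?_)
    rw [hK]; ring
  · have hle := abs_re_mul_sq_le C ζ
    rw [hζ, ← ht] at hle
    rw [sub_add_cancel_left, abs_neg]
    nlinarith [abs_le.1 (hw ζ hζ), mul_nonneg (norm_nonneg C) ht0]
  · rw [meanWith_abs_cos_eq_transfer (hsmall ζ hζ), ht, ← hζ]
    exact transfer_one_add_le (hsmall ζ hζ) hu hC
  · have hle := abs_transfer_sub_le hC hu (norm_le_one_of_mul_sq_le (hsmall ζ hζ))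
    rw [hζ, ← ht] at hle
    have hhalf : 1 / 2 ≤ Real.exp (-(W.halfVar * t / 2)) * (1 + (C * ζ ^ 2).re) := by
      nlinarith [abs_le.1 (hw ζ hζ)]
    nlinarith [mul_nonneg (by positivity : 0 ≤ K) (sq_nonneg t)]

end

theorem exists_abs_char_sub_exp_le (W : StepWeights) (hu : ‖u‖ = 1) (him : u.im ≠ 0) :
    ∃ κ : ℝ, 0 < κ ∧ ∃ A : ℝ, 0 < A ∧ ∀ n : ℕ, 0 < n → ∀ ξ : ℂ, ‖ξ‖ ≤ κ →
      |W.char u n ξ - Real.exp (-(n * W.halfVar * ‖ξ‖ ^ 2))|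
        ≤ A / n * Real.exp (-(W.halfVar / 4 * n * ‖ξ‖ ^ 2)) := by
  obtain ⟨C, hC⟩ := exists_corrector (W := W) hu him
  have hq := W.halfVar_pos
  set q := W.halfVar
  set κ := √(q / (16 * (1 + ‖C‖)))
  refine ⟨κ, by positivity, 8 * (1 + ‖C‖) * (1 / (q / 4) + 2 / (q / 4) ^ 2), by positivity,
    fun n hn ξ hξ => ?_⟩
  have hn0 : (0 : ℝ) < n := by exact_mod_cast hn
  set t := ‖ξ‖ ^ 2 with ht
  have ht0 : 0 ≤ t := by positivity
  have hsmall : 2 * (1 + ‖C‖) * t ≤ q / 8 := by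
    have hle : t ≤ κ ^ 2 := by rw [ht]; gcongr
    rw [Real.sq_sqrt (by positivity), le_div_iff₀ (by positivity)] at hle
    linarith
  have hmain := abs_char_sub_exp_pow_mul_le hsmall hu hC n
  rw [← Real.exp_nat_mul, ← Real.exp_nat_mul] at hmain
  have hcorr : |Real.exp (n * -(q * t)) * (C * ξ ^ 2).re|
      ≤ Real.exp (n * -(q * t / 2)) * (4 * (1 + ‖C‖) * t) := by
    rw [abs_mul, abs_of_pos (Real.exp_pos _)]
    gcongr ?_ * ?_
    · exact Real.exp_le_exp.2 (by nlinarith [mul_nonneg hn0.le (mul_nonneg hq.le ht0)])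
    · exact (abs_re_mul_sq_le C ξ).trans (by gcongr; linarith [norm_nonneg C])
  calc |W.char u n ξ - Real.exp (-(n * q * t))|
      = |(W.char u n ξ - Real.exp (n * -(q * t)) * (1 + (C * ξ ^ 2).re))
          + Real.exp (n * -(q * t)) * (C * ξ ^ 2).re| := by
        rw [show -(n * q * t) = n * -(q * t) by ring]; congr 1; ring
    _ ≤ 8 * (1 + ‖C‖) * (t + n * t ^ 2) * Real.exp (n * -(q * t / 2)) :=
        (abs_add_le _ _).trans (by linarith)
    _ = 8 * (1 + ‖C‖) / n * ((n * t + (n * t) ^ 2) * Real.exp (-(q / 4 * (n * t))))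
          * Real.exp (-(q / 4 * n * t)) := by
        rw [show n * -(q * t / 2) = -(q / 4 * (n * t)) + -(q / 4 * n * t) by ring, Real.exp_add]
        field_simp
    _ ≤ 8 * (1 + ‖C‖) / n * (1 / (q / 4) + 2 / (q / 4) ^ 2) * Real.exp (-(q / 4 * n * t)) := by
        gcongr
        exact linear_add_sq_mul_exp_le (by positivity) (by positivity)
    _ = _ := by ring

end LowFrequency

end StepWeights

section Gaussian

theorem integral_exp_neg_mul_sq_norm {b : ℝ} (hb : 0 < b) :
    ∫ v : ℂ, Real.exp (-b * ‖v‖ ^ 2) = Real.pi / b := by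
  rw [GaussianFourier.integral_rexp_neg_mul_sq_norm hb, Complex.finrank_real_complex]
  norm_num

theorem integrable_exp_neg_mul_sq_norm {b : ℝ} (hb : 0 < b) :
    Integrable fun v : ℂ => Real.exp (-b * ‖v‖ ^ 2) :=
  Integrable.of_integral_ne_zero (by
    rw [integral_exp_neg_mul_sq_norm hb]; exact (div_pos Real.pi_pos hb).ne')

theorem integrable_cexp_neg_mul_sq_norm_add_inner {b : ℝ} (hb : 0 < b) (c x : ℂ) :
    Integrable fun v : ℂ => Complex.exp (-(b : ℂ) * ‖v‖ ^ 2 + c * (inner ℝ x v : ℝ)) :=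
  GaussianFourier.integrable_cexp_neg_mul_sq_norm_add (by simpa using hb) c x

theorem integral_cexp_neg_mul_sq_norm_add_inner {b : ℝ} (hb : 0 < b) (c x : ℂ) :
    ∫ v : ℂ, Complex.exp (-(b : ℂ) * ‖v‖ ^ 2 + c * (inner ℝ x v : ℝ))
      = Real.pi / b * Complex.exp (c ^ 2 * ‖x‖ ^ 2 / (4 * b)) := by
  rw [GaussianFourier.integral_cexp_neg_mul_sq_norm_add (by simpa using hb) c x,
    Complex.finrank_real_complex, Nat.cast_ofNat, div_self two_ne_zero, Complex.cpow_one]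

/-- The density of the centred isotropic Gaussian on the plane with variance `s ^ 2` in each
coordinate. -/
noncomputable def gaussianKernel (s : ℝ) (x : ℂ) : ℝ :=
  (2 * Real.pi * s ^ 2)⁻¹ * Real.exp (-(1 / (2 * s ^ 2)) * ‖x‖ ^ 2)

/-- The centred isotropic Gaussian on the plane with variance `s ^ 2` in each coordinate. -/
noncomputable def planarGaussian (s : ℝ) : Measure ℂ :=
  volume.withDensity fun x => ENNReal.ofReal (gaussianKernel s x)

theorem gaussianKernel_nonneg (s : ℝ) (x : ℂ) : 0 ≤ gaussianKernel s x := by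
  unfold gaussianKernel
  positivity

theorem gaussianKernel_le (s : ℝ) (x : ℂ) : gaussianKernel s x ≤ (2 * Real.pi * s ^ 2)⁻¹ :=
  mul_le_of_le_one_right (by positivity)
    (Real.exp_le_one_iff.2
      (mul_nonpos_of_nonpos_of_nonneg (neg_nonpos.2 (by positivity)) (sq_nonneg _)))

@[fun_prop]
theorem continuous_gaussianKernel (s : ℝ) : Continuous (gaussianKernel s) := by
  unfold gaussianKernel
  fun_prop

variable {s : ℝ}

theorem integrable_gaussianKernel (hs : 0 < s) : Integrable (gaussianKernel s) :=
  (integrable_exp_neg_mul_sq_norm (by positivity)).const_mul _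

theorem integral_gaussianKernel (hs : 0 < s) : ∫ x, gaussianKernel s x = 1 := by
  unfold gaussianKernel
  rw [integral_const_mul, integral_exp_neg_mul_sq_norm (by positivity)]
  field_simp

theorem isProbabilityMeasure_planarGaussian (hs : 0 < s) :
    IsProbabilityMeasure (planarGaussian s) := by
  constructor
  rw [planarGaussian, withDensity_apply _ MeasurableSet.univ, Measure.restrict_univ,
    ← ofReal_integral_eq_lintegral_ofReal (integrable_gaussianKernel hs)
      (Filter.Eventually.of_forall (gaussianKernel_nonneg s)), integral_gaussianKernel hs,
    ENNReal.ofReal_one]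

theorem planarGaussian_le_volume {S : Set ℂ} (hS : MeasurableSet S) :
    planarGaussian s S ≤ ENNReal.ofReal (2 * Real.pi * s ^ 2)⁻¹ * volume S := by
  rw [planarGaussian, withDensity_apply _ hS, ← setLIntegral_const]
  exact lintegral_mono fun x => ENNReal.ofReal_le_ofReal (gaussianKernel_le s x)

theorem charFun_planarGaussian (hs : 0 < s) (t : ℂ) :
    charFun (planarGaussian s) t = Complex.exp (-(s ^ 2 * ‖t‖ ^ 2 / 2 : ℝ)) := by
  have hs' : (s : ℂ) ≠ 0 := by exact_mod_cast hs.ne'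
  have hpi : (Real.pi : ℂ) ≠ 0 := by exact_mod_cast Real.pi_ne_zero
  have hintegrand : ∀ x : ℂ, (ENNReal.ofReal (gaussianKernel s x)).toReal
      • Complex.exp ((inner ℝ x t : ℝ) * Complex.I)
      = ((2 * Real.pi * s ^ 2)⁻¹ : ℝ) * Complex.exp (-((1 / (2 * s ^ 2) : ℝ) : ℂ) * ‖x‖ ^ 2
        + Complex.I * (inner ℝ t x : ℝ)) := fun x => by
    rw [ENNReal.toReal_ofReal (gaussianKernel_nonneg s x), gaussianKernel, Complex.real_smul,
      Complex.exp_add, real_inner_comm]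
    push_cast
    ring_nf
  rw [charFun_apply, planarGaussian, integral_withDensity_eq_integral_toReal_smul
    (by fun_prop) (Filter.Eventually.of_forall fun x => ENNReal.ofReal_lt_top)]
  simp_rw [hintegrand]
  rw [integral_const_mul, integral_cexp_neg_mul_sq_norm_add_inner (by positivity), Complex.I_sq,
    ← mul_assoc]
  convert one_mul _ using 2
  · push_cast
    field_simp
  · push_cast
    field_simp
    norm_num

theorem map_smul_stdGaussian (hs : 0 < s) :
    (stdGaussian ℂ).map (fun z => s • z) = planarGaussian s := by
  have := isProbabilityMeasure_planarGaussian hs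
  have : IsProbabilityMeasure ((stdGaussian ℂ).map (fun z => s • z)) :=
    Measure.isProbabilityMeasure_map (by fun_prop)
  refine Measure.ext_of_charFun (funext fun t => ?_)
  rw [charFun_map_smul, charFun_stdGaussian, charFun_planarGaussian hs, norm_smul,
    Real.norm_of_nonneg hs.le]
  push_cast
  ring_nf

theorem gaussianKernel_le_of_le_norm {ε : ℝ} (hs : 0 < s) {x : ℂ} (hx : ε ^ 2 ≤ ‖x‖ ^ 2) :
    gaussianKernel s x ≤ (2 * Real.pi * s ^ 2)⁻¹ * Real.exp (-(1 / (4 * s ^ 2)) * ε ^ 2)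
      * Real.exp (-(1 / (4 * s ^ 2)) * ‖x‖ ^ 2) := by
  rw [gaussianKernel, mul_assoc _ (Real.exp _), ← Real.exp_add]
  gcongr
  have hsplit : 1 / (2 * s ^ 2) = 1 / (4 * s ^ 2) + 1 / (4 * s ^ 2) := by field_simp; norm_num
  have hle : 1 / (4 * s ^ 2) * ε ^ 2 ≤ 1 / (4 * s ^ 2) * ‖x‖ ^ 2 := by gcongr
  rw [hsplit]
  linarith

theorem planarGaussian_tail_le {ε : ℝ} (hs : 0 < s) (hε : 0 < ε) :
    (planarGaussian s).real {u : ℂ | ε ≤ ‖u‖} ≤ 8 * s ^ 2 / ε ^ 2 := by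
  have hS : MeasurableSet {u : ℂ | ε ≤ ‖u‖} := measurableSet_le measurable_const measurable_norm
  set b := 1 / (4 * s ^ 2) with hb
  have hb0 : 0 < b := by positivity
  set K := (2 * Real.pi * s ^ 2)⁻¹ * Real.exp (-b * ε ^ 2) with hK
  have hle : planarGaussian s {u : ℂ | ε ≤ ‖u‖}
      ≤ ∫⁻ u : ℂ, ENNReal.ofReal (K * Real.exp (-b * ‖u‖ ^ 2)) := by
    rw [planarGaussian, withDensity_apply _ hS]
    refine (setLIntegral_mono' hS fun u hu => ENNReal.ofReal_le_ofReal ?_).trans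
      (setLIntegral_le_lintegral _ _)
    exact gaussianKernel_le_of_le_norm hs (by gcongr; exact hu)
  rw [← ofReal_integral_eq_lintegral_ofReal ((integrable_exp_neg_mul_sq_norm hb0).const_mul _)
    (Filter.Eventually.of_forall fun u => by positivity), integral_const_mul,
    integral_exp_neg_mul_sq_norm hb0] at hle
  have hexp : Real.exp (-b * ε ^ 2) ≤ 1 / (b * ε ^ 2) := by
    rw [neg_mul, Real.exp_neg, ← one_div]
    exact one_div_le_one_div_of_le (by positivity) (by linarith [Real.add_one_le_exp (b * ε ^ 2)])
  calc (planarGaussian s).real {u : ℂ | ε ≤ ‖u‖} ≤ K * (Real.pi / b) :=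
        ENNReal.toReal_le_of_le_ofReal (by positivity) hle
    _ ≤ (2 * Real.pi * s ^ 2)⁻¹ * (1 / (b * ε ^ 2)) * (Real.pi / b) := by rw [hK]; gcongr
    _ = 8 * s ^ 2 / ε ^ 2 := by rw [hb]; field_simp; norm_num

end Gaussian

section FourierInversion

variable {s : ℝ}

theorem gaussianKernel_eq_integral (hs : 0 < s) (x : ℂ) :
    (gaussianKernel s x : ℂ) = ((4 * Real.pi ^ 2)⁻¹ : ℝ) *
      ∫ ξ : ℂ, Complex.exp (-((s ^ 2 / 2 : ℝ) : ℂ) * ‖ξ‖ ^ 2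
        + (-Complex.I) * (inner ℝ x ξ : ℝ)) := by
  have hs' : (s : ℂ) ≠ 0 := by exact_mod_cast hs.ne'
  have hpi : (Real.pi : ℂ) ≠ 0 := by exact_mod_cast Real.pi_ne_zero
  rw [integral_cexp_neg_mul_sq_norm_add_inner (by positivity), gaussianKernel, neg_sq,
    Complex.I_sq, ← mul_assoc]
  push_cast
  congr 1
  · field_simp
    norm_num
  · congr 1
    field_simp
    ring

theorem integral_gaussianKernel_sub (hs : 0 < s) (ν : Measure ℂ) [IsProbabilityMeasure ν]
    (x : ℂ) :
    ((∫ y, gaussianKernel s (x - y) ∂ν : ℝ) : ℂ) = ((4 * Real.pi ^ 2)⁻¹ : ℝ) *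
      ∫ ξ : ℂ, Complex.exp (-((s ^ 2 / 2 : ℝ) : ℂ) * ‖ξ‖ ^ 2
        + (-Complex.I) * (inner ℝ x ξ : ℝ)) * charFun ν ξ := by
  have hsplit : ∀ y ξ : ℂ, Complex.exp (-((s ^ 2 / 2 : ℝ) : ℂ) * ‖ξ‖ ^ 2
        + (-Complex.I) * (inner ℝ (x - y) ξ : ℝ))
      = Complex.exp (-((s ^ 2 / 2 : ℝ) : ℂ) * ‖ξ‖ ^ 2 + (-Complex.I) * (inner ℝ x ξ : ℝ))
        * Complex.exp ((inner ℝ y ξ : ℝ) * Complex.I) := fun y ξ => by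
    rw [← Complex.exp_add, inner_sub_left]
    push_cast
    ring_nf
  rw [← integral_complex_ofReal]
  simp_rw [gaussianKernel_eq_integral hs]
  rw [integral_const_mul, integral_integral_swap]
  · simp only [hsplit, integral_const_mul, charFun_apply]
  · have hint : Integrable (fun p : ℂ × ℂ => Complex.exp (-((s ^ 2 / 2 : ℝ) : ℂ) * ‖p.2‖ ^ 2
        + (-Complex.I) * (inner ℝ x p.2 : ℝ))) (ν.prod volume) :=
      (integrable_cexp_neg_mul_sq_norm_add_inner (by positivity) _ x).comp_snd ν
    refine hint.mono (Continuous.aestronglyMeasurable ?_) (Filter.Eventually.of_forall fun p => ?_)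
    · unfold Function.uncurry
      fun_prop
    · rw [Function.uncurry, hsplit, norm_mul, Complex.norm_exp_ofReal_mul_I, mul_one]

theorem abs_integral_gaussianKernel_sub_le (hs : 0 < s) (ν₁ ν₂ : Measure ℂ)
    [IsProbabilityMeasure ν₁] [IsProbabilityMeasure ν₂] {G : ℂ → ℝ} (hG : Integrable G)
    (h : ∀ ξ, Real.exp (-(s ^ 2 / 2) * ‖ξ‖ ^ 2) * ‖charFun ν₁ ξ - charFun ν₂ ξ‖ ≤ G ξ) (x : ℂ) :
    |∫ y, gaussianKernel s (x - y) ∂ν₁ - ∫ y, gaussianKernel s (x - y) ∂ν₂| ≤ ∫ ξ, G ξ := by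
  have hint : ∀ (ν : Measure ℂ) [IsProbabilityMeasure ν],
      Integrable fun ξ : ℂ => Complex.exp (-((s ^ 2 / 2 : ℝ) : ℂ) * ‖ξ‖ ^ 2
        + (-Complex.I) * (inner ℝ x ξ : ℝ)) * charFun ν ξ := fun ν _ =>
    (integrable_cexp_neg_mul_sq_norm_add_inner (by positivity) _ x).mul_bdd (c := 1)
      measurable_charFun.aestronglyMeasurable
      (Filter.Eventually.of_forall fun ξ => norm_charFun_le_one ξ)
  rw [← Real.norm_eq_abs, ← Complex.norm_real, Complex.ofReal_sub,
    integral_gaussianKernel_sub hs ν₁, integral_gaussianKernel_sub hs ν₂, ← mul_sub,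
    ← integral_sub (hint ν₁) (hint ν₂), norm_mul, Complex.norm_real,
    Real.norm_of_nonneg (by positivity)]
  refine (mul_le_of_le_one_left (norm_nonneg _)
    (inv_le_one_of_one_le₀ (by nlinarith [Real.pi_gt_three]))).trans ?_
  refine norm_integral_le_of_norm_le hG (Filter.Eventually.of_forall fun ξ => ?_)
  refine le_trans (le_of_eq ?_) (h ξ)
  rw [← mul_sub, norm_mul, Complex.norm_exp]
  congr 2
  simp [← Complex.ofReal_pow]

end FourierInversion

section Convolution

theorem conv_withDensity_apply {E : Type*} [AddCommGroup E] [MeasurableSpace E] [MeasurableAdd₂ E]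
    [MeasurableSub₂ E] (ν m : Measure E) [SFinite ν] [SFinite m] [m.IsAddRightInvariant]
    {k : E → ℝ≥0∞} (hk : Measurable k) {B : Set E} (hB : MeasurableSet B) :
    (ν ∗ m.withDensity k) B = ∫⁻ x in B, ∫⁻ y, k (x - y) ∂ν ∂m := by
  have hind : Measurable (B.indicator (1 : E → ℝ≥0∞)) := measurable_one.indicator hB
  have htranslate : ∀ y, ∫⁻ u, B.indicator 1 (y + u) ∂(m.withDensity k)
      = ∫⁻ x, k (x - y) * B.indicator 1 x ∂m := fun y => by
    have hcomp : Measurable fun u => B.indicator (1 : E → ℝ≥0∞) (y + u) :=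
      hind.comp (measurable_const_add y)
    rw [lintegral_withDensity_eq_lintegral_mul _ hk hcomp, ← lintegral_sub_right_eq_self _ y]
    simp
  rw [← lintegral_indicator_one hB, Measure.lintegral_conv hind]
  simp_rw [htranslate]
  rw [lintegral_lintegral_swap, ← lintegral_indicator hB]
  · refine lintegral_congr fun x => ?_
    by_cases hx : x ∈ B <;> simp [hx]
  · exact ((hk.comp (measurable_snd.sub measurable_fst)).mul
      (hind.comp measurable_snd)).aemeasurable

variable {s : ℝ} (ν ν₁ ν₂ : Measure ℂ) [IsProbabilityMeasure ν] [IsProbabilityMeasure ν₁]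
  [IsProbabilityMeasure ν₂] {B : Set ℂ}

theorem conv_planarGaussian_apply (hB : MeasurableSet B) :
    (ν ∗ planarGaussian s) B = ∫⁻ x in B, ENNReal.ofReal (∫ y, gaussianKernel s (x - y) ∂ν) := by
  rw [planarGaussian, conv_withDensity_apply ν volume (by fun_prop) hB]
  refine lintegral_congr fun x => (ofReal_integral_eq_lintegral_ofReal ?_ ?_).symm
  · refine Integrable.of_bound (C := (2 * Real.pi * s ^ 2)⁻¹)
      (Continuous.aestronglyMeasurable (by fun_prop)) (Filter.Eventually.of_forall fun y => ?_)
    rw [Real.norm_of_nonneg (gaussianKernel_nonneg _ _)]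
    exact gaussianKernel_le _ _
  · exact Filter.Eventually.of_forall fun y => gaussianKernel_nonneg _ _

theorem conv_planarGaussian_le {D : ℝ} (hD : 0 ≤ D)
    (h : ∀ x, |∫ y, gaussianKernel s (x - y) ∂ν₁ - ∫ y, gaussianKernel s (x - y) ∂ν₂| ≤ D)
    (hB : MeasurableSet B) :
    (ν₁ ∗ planarGaussian s) B ≤ (ν₂ ∗ planarGaussian s) B + ENNReal.ofReal D * volume B := by
  rw [conv_planarGaussian_apply ν₁ hB, conv_planarGaussian_apply ν₂ hB, ← setLIntegral_const,
    ← lintegral_add_right _ measurable_const]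
  refine lintegral_mono fun x => ?_
  rw [← ENNReal.ofReal_add (integral_nonneg fun y => gaussianKernel_nonneg _ _) hD]
  exact ENNReal.ofReal_le_ofReal (by linarith [(abs_le.1 (h x)).2])

theorem volume_ball_eq (x : ℂ) {R : ℝ} (hR : 0 ≤ R) :
    volume (Metric.ball x R) = ENNReal.ofReal (Real.pi * R ^ 2) := by
  rw [Complex.volume_ball, ENNReal.ofReal_mul Real.pi_pos.le, ← ENNReal.ofReal_pow hR, mul_comm,
    ← NNReal.coe_real_pi, ENNReal.ofReal_coe_nnreal]

theorem conv_planarGaussian_real_ball_le {D : ℝ} (hs : 0 < s) (hD : 0 ≤ D)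
    (h : ∀ x, |∫ y, gaussianKernel s (x - y) ∂ν₁ - ∫ y, gaussianKernel s (x - y) ∂ν₂| ≤ D)
    (x : ℂ) {R : ℝ} (hR : 0 ≤ R) :
    (ν₁ ∗ planarGaussian s).real (Metric.ball x R)
      ≤ (ν₂ ∗ planarGaussian s).real (Metric.ball x R) + Real.pi * D * R ^ 2 := by
  have := isProbabilityMeasure_planarGaussian hs
  have hle := conv_planarGaussian_le ν₁ ν₂ hD h (B := Metric.ball x R)
    Metric.isOpen_ball.measurableSet
  rw [volume_ball_eq x hR, ← ENNReal.ofReal_mul hD, ← ofReal_measureReal (measure_ne_top _ _),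
    ← ofReal_measureReal (measure_ne_top _ _),
    ← ENNReal.ofReal_add measureReal_nonneg (by positivity),
    ENNReal.ofReal_le_ofReal_iff (by positivity)] at hle
  linarith

end Convolution

theorem planarGaussian_real_ball_le {s : ℝ} (hs : 0 < s) (x : ℂ) {R R' : ℝ} (hR : 0 ≤ R)
    (hRR' : R ≤ R') :
    (planarGaussian s).real (Metric.ball x R')
      ≤ (planarGaussian s).real (Metric.ball x R) + (2 * s ^ 2)⁻¹ * (R' ^ 2 - R ^ 2) := by
  have := isProbabilityMeasure_planarGaussian hs
  have hsub := Metric.ball_subset_ball (x := x) hRR'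
  have hm : MeasurableSet (Metric.ball x R) := Metric.isOpen_ball.measurableSet
  have hm' : MeasurableSet (Metric.ball x R') := Metric.isOpen_ball.measurableSet
  have hsq : R ^ 2 ≤ R' ^ 2 := by gcongr
  have hdiff : (planarGaussian s).real (Metric.ball x R' \ Metric.ball x R)
      ≤ (2 * s ^ 2)⁻¹ * (R' ^ 2 - R ^ 2) := by
    refine ENNReal.toReal_le_of_le_ofReal (mul_nonneg (by positivity) (sub_nonneg.2 hsq)) ?_
    refine (planarGaussian_le_volume (hm'.diff hm)).trans (le_of_eq ?_)
    rw [measure_sdiff hsub hm.nullMeasurableSet measure_ball_lt_top.ne, volume_ball_eq x hR,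
      volume_ball_eq x (hR.trans hRR'), ← ENNReal.ofReal_sub _ (by positivity),
      ← ENNReal.ofReal_mul (by positivity)]
    congr 1
    field_simp
  rw [measureReal_sdiff hsub hm] at hdiff
  linarith

section Smoothing

theorem measurableSet_le_norm {E : Type*} [NormedAddCommGroup E] [MeasurableSpace E]
    [OpensMeasurableSpace E] (ε : ℝ) : MeasurableSet {u : E | ε ≤ ‖u‖} :=
  measurableSet_le measurable_const measurable_norm

variable {E : Type*} [NormedAddCommGroup E] [SecondCountableTopology E] [MeasurableSpace E]
  [BorelSpace E]

theorem ball_mul_le_conv (ν γ : Measure E) [IsProbabilityMeasure ν] [IsProbabilityMeasure γ]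
    (x : E) (R ε : ℝ) :
    ν.real (Metric.ball x R) * (1 - γ.real {u | ε ≤ ‖u‖})
      ≤ (ν ∗ γ).real (Metric.ball x (R + ε)) := by
  rw [← probReal_compl_eq_one_sub (measurableSet_le_norm ε), ← measureReal_prod_prod,
    Measure.conv, map_measureReal_apply (by fun_prop) Metric.isOpen_ball.measurableSet]
  refine measureReal_mono fun p ⟨hp₁, hp₂⟩ => ?_
  rw [Metric.mem_ball, dist_eq_norm] at hp₁
  rw [Set.mem_compl_iff, Set.mem_ofPred_eq, not_le] at hp₂
  rw [Set.mem_preimage, Metric.mem_ball, dist_eq_norm]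
  calc ‖p.1 + p.2 - x‖ = ‖(p.1 - x) + p.2‖ := by congr 1; abel
    _ ≤ ‖p.1 - x‖ + ‖p.2‖ := norm_add_le _ _
    _ < R + ε := add_lt_add hp₁ hp₂

theorem prod_norm_ge_inter_add_mem_ball_le (ν γ : Measure E) [IsProbabilityMeasure ν]
    [IsProbabilityMeasure γ] (x : E) {R ε m : ℝ} (hm : ∀ y, ν.real (Metric.ball y R) ≤ m) :
    (ν.prod γ).real {p | ε ≤ ‖p.2‖ ∧ p.1 + p.2 ∈ Metric.ball x R} ≤ γ.real {u | ε ≤ ‖u‖} * m := by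
  have hm0 : 0 ≤ m := measureReal_nonneg.trans (hm 0)
  have hS := measurableSet_le_norm (E := E) ε
  have hT : MeasurableSet {p : E × E | ε ≤ ‖p.2‖ ∧ p.1 + p.2 ∈ Metric.ball x R} :=
    (measurable_snd hS).inter
      ((measurable_fst.add measurable_snd) Metric.isOpen_ball.measurableSet)
  refine ENNReal.toReal_le_of_le_ofReal (by positivity) ?_
  rw [ENNReal.ofReal_mul measureReal_nonneg, ofReal_measureReal (measure_ne_top _ _),
    Measure.prod_apply_symm hT, mul_comm, ← setLIntegral_const, ← lintegral_indicator hS]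
  refine lintegral_mono fun u => ?_
  by_cases hu : ε ≤ ‖u‖
  · rw [Set.indicator_of_mem (show u ∈ {u : E | ε ≤ ‖u‖} from hu)]
    refine (measure_mono (t := Metric.ball (x - u) R) fun y hy => ?_).trans
      ((ENNReal.le_ofReal_iff_toReal_le (measure_ne_top _ _) hm0).2 (hm (x - u)))
    simpa only [Metric.mem_ball, dist_eq_norm, sub_sub_eq_add_sub] using hy.2
  · simp [hu]

theorem conv_le_ball_add (ν γ : Measure E) [IsProbabilityMeasure ν] [IsProbabilityMeasure γ]
    (x : E) {R ε m : ℝ} (hm : ∀ y, ν.real (Metric.ball y R) ≤ m) :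
    (ν ∗ γ).real (Metric.ball x R)
      ≤ ν.real (Metric.ball x (R + ε)) + γ.real {u | ε ≤ ‖u‖} * m := by
  have hcover : (fun p : E × E => p.1 + p.2) ⁻¹' Metric.ball x R
      ⊆ (Metric.ball x (R + ε) ×ˢ Set.univ)
        ∪ {p | ε ≤ ‖p.2‖ ∧ p.1 + p.2 ∈ Metric.ball x R} := fun p hp => by
    rcases le_or_gt ε ‖p.2‖ with hε | hε
    · exact Or.inr ⟨hε, hp⟩
    · refine Or.inl ⟨?_, trivial⟩
      rw [Set.mem_preimage, Metric.mem_ball, dist_eq_norm] at hp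
      rw [Metric.mem_ball, dist_eq_norm]
      calc ‖p.1 - x‖ = ‖(p.1 + p.2 - x) - p.2‖ := by congr 1; abel
        _ ≤ ‖p.1 + p.2 - x‖ + ‖p.2‖ := norm_sub_le _ _
        _ < R + ε := add_lt_add hp hε
  rw [Measure.conv, map_measureReal_apply (by fun_prop) Metric.isOpen_ball.measurableSet]
  refine (measureReal_mono hcover).trans ((measureReal_union_le _ _).trans ?_)
  rw [measureReal_prod_prod, probReal_univ, mul_one]
  exact add_le_add_right (prod_norm_ge_inter_add_mem_ball_le ν γ x hm) _

theorem ball_mul_le_of_ball_le {X : Type*} [MetricSpace X] [MeasurableSpace X] {ν : Measure X}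
    {M r : ℝ} (hr : 0 ≤ r)
    (hν : ∀ (x : X) (R R' : ℝ), 0 ≤ R → R ≤ R' →
      ν.real (Metric.ball x R') ≤ ν.real (Metric.ball x R) + M * (R' ^ 2 - R ^ 2))
    {k : ℝ} (hk : 0 ≤ k) (x : X) : ν.real (Metric.ball x (k * r)) ≤ M * r ^ 2 * k ^ 2 := by
  have hle := hν x 0 (k * r) le_rfl (mul_nonneg hk hr)
  rw [Metric.ball_zero, measureReal_empty] at hle
  linarith

theorem mul_sq_mul_add_le {η₀ η M D r : ℝ} (hM : 0 ≤ M) (hD : 0 ≤ D) (hη : η₀ ≤ η)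
    (hη1 : η ≤ 1 / 2) : η₀ * (r ^ 2 * (11 * M + 6 * D)) ≤ r ^ 2 * (11 * η * M + 3 * D) :=
  calc η₀ * (r ^ 2 * (11 * M + 6 * D)) = r ^ 2 * (11 * η₀ * M + η₀ * (6 * D)) := by ring
    _ ≤ r ^ 2 * (11 * η * M + 1 / 2 * (6 * D)) := by gcongr; exact hη.trans hη1
    _ = r ^ 2 * (11 * η * M + 3 * D) := by ring

variable {ν₁ ν₂ γ : Measure E} [IsProbabilityMeasure ν₁] [IsProbabilityMeasure ν₂]
  [IsProbabilityMeasure γ] {M D δ η r : ℝ} (hM : 0 ≤ M) (hD : 0 ≤ D) (hr : 0 ≤ r) (hδ : 0 ≤ δ)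
  (hδ1 : δ ≤ 1 / 2)
  (hν : ∀ (x : E) (R R' : ℝ), 0 ≤ R → R ≤ R' →
    ν₂.real (Metric.ball x R') ≤ ν₂.real (Metric.ball x R) + M * (R' ^ 2 - R ^ 2))
  (h₁₂ : ∀ (x : E) (R : ℝ), 0 ≤ R →
    (ν₁ ∗ γ).real (Metric.ball x R) ≤ (ν₂ ∗ γ).real (Metric.ball x R) + D * R ^ 2)

include hM hD hr hδ hδ1 hν h₁₂

theorem ball_mul_one_sub_le (x : E) :
    ν₁.real (Metric.ball x r) * (1 - γ.real {u | δ * r ≤ ‖u‖})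
      ≤ ν₂.real (Metric.ball x r)
        + r ^ 2 * (6 * δ * M + 3 * γ.real {u | δ * r ≤ ‖u‖} * M + 3 * D) := by
  have hδr : 0 ≤ δ * r := mul_nonneg hδ hr
  have hsq : (1 + δ) ^ 2 ≤ 3 := by nlinarith
  have hball : ∀ y, ν₂.real (Metric.ball y (r + δ * r)) ≤ M * r ^ 2 * 3 := fun y => by
    rw [show r + δ * r = (1 + δ) * r by ring]
    exact (ball_mul_le_of_ball_le hr hν (by positivity) y).trans (by gcongr)
  have hannulus : M * ((r + δ * r + δ * r) ^ 2 - r ^ 2) ≤ M * r ^ 2 * (6 * δ) :=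
    calc _ = M * r ^ 2 * (4 * δ + 4 * δ ^ 2) := by ring
      _ ≤ _ := by gcongr; nlinarith
  have herror : D * (r + δ * r) ^ 2 ≤ D * r ^ 2 * 3 :=
    calc _ = D * r ^ 2 * (1 + δ) ^ 2 := by ring
      _ ≤ _ := by gcongr
  linarith [ball_mul_le_conv ν₁ γ x r (δ * r), h₁₂ x (r + δ * r) (by positivity),
    conv_le_ball_add ν₂ γ x (ε := δ * r) hball,
    hν x r (r + δ * r + δ * r) hr (by linarith)]

theorem ball_le_of_conv_le (hη : γ.real {u | δ * r ≤ ‖u‖} ≤ 1 / 2) (x : E) :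
    ν₁.real (Metric.ball x r) ≤ r ^ 2 * (11 * M + 6 * D) := by
  have hball := ball_mul_le_of_ball_le hr hν zero_le_one x
  rw [one_mul] at hball
  have hhalf : ν₁.real (Metric.ball x r) * (1 / 2)
      ≤ ν₁.real (Metric.ball x r) * (1 - γ.real {u | δ * r ≤ ‖u‖}) :=
    mul_le_mul_of_nonneg_left (by linarith) measureReal_nonneg
  have hbound : r ^ 2 * (6 * δ * M + 3 * γ.real {u | δ * r ≤ ‖u‖} * M + 3 * D)
      ≤ r ^ 2 * (6 * (1 / 2) * M + 3 * (1 / 2) * M + 3 * D) := by gcongr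
  linarith [ball_mul_one_sub_le hM hD hr hδ hδ1 hν h₁₂ x]

theorem ball_sub_le_of_conv_le (hη : γ.real {u | δ * r ≤ ‖u‖} ≤ η) (hη1 : η ≤ 1 / 2) (x : E) :
    ν₁.real (Metric.ball x r) - ν₂.real (Metric.ball x r)
      ≤ r ^ 2 * (6 * δ * M + 14 * η * M + 6 * D) := by
  have hle : r ^ 2 * (6 * δ * M + 3 * γ.real {u | δ * r ≤ ‖u‖} * M + 3 * D)
      ≤ r ^ 2 * (6 * δ * M + 3 * η * M + 3 * D) := by gcongr
  linarith [ball_mul_one_sub_le hM hD hr hδ hδ1 hν h₁₂ x,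
    mul_sq_mul_add_le (r := r) hM hD hη hη1,
    mul_le_mul_of_nonneg_left (ball_le_of_conv_le hM hD hr hδ hδ1 hν h₁₂ (hη.trans hη1) x)
      (measureReal_nonneg (μ := γ) (s := {u | δ * r ≤ ‖u‖}))]

theorem le_ball_sub_of_conv_le (hη : γ.real {u | δ * r ≤ ‖u‖} ≤ η) (hη1 : η ≤ 1 / 2)
    (h₂₁ : ∀ (x : E) (R : ℝ), 0 ≤ R →
      (ν₂ ∗ γ).real (Metric.ball x R) ≤ (ν₁ ∗ γ).real (Metric.ball x R) + D * R ^ 2) (x : E) :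
    ν₂.real (Metric.ball x r) - ν₁.real (Metric.ball x r)
      ≤ r ^ 2 * (4 * δ * M + 12 * η * M + 4 * D) := by
  set η₀ := γ.real {u | δ * r ≤ ‖u‖} with hη₀
  have hη₀0 : 0 ≤ η₀ := measureReal_nonneg
  have hMr : 0 ≤ M * r ^ 2 := by positivity
  have hannulus : M * (r ^ 2 - ((1 - 2 * δ) * r) ^ 2) ≤ M * r ^ 2 * (4 * δ) :=
    calc _ = M * r ^ 2 * (4 * δ - 4 * δ ^ 2) := by ring
      _ ≤ _ := by gcongr; nlinarith
  have hinner : ν₂.real (Metric.ball x ((1 - 2 * δ) * r)) * η₀ ≤ M * r ^ 2 * η :=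
    mul_le_mul ((ball_mul_le_of_ball_le hr hν (by linarith) x).trans
      (mul_le_of_le_one_right hMr (by nlinarith))) hη hη₀0 hMr
  have hsmooth := ball_mul_le_conv ν₂ γ x ((1 - 2 * δ) * r) (δ * r)
  rw [show (1 - 2 * δ) * r + δ * r = (1 - δ) * r by ring, ← hη₀] at hsmooth
  have hunsmooth := conv_le_ball_add ν₁ γ x (R := (1 - δ) * r) (ε := δ * r)
    (m := r ^ 2 * (11 * M + 6 * D)) fun y =>
      (measureReal_mono (Metric.ball_subset_ball (by nlinarith))).trans
        (ball_le_of_conv_le hM hD hr hδ hδ1 hν h₁₂ (hη.trans hη1) y)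
  rw [show (1 - δ) * r + δ * r = r by ring, ← hη₀] at hunsmooth
  have herror : D * ((1 - δ) * r) ^ 2 ≤ D * r ^ 2 := by
    gcongr
    · exact mul_nonneg (by linarith) hr
    · exact mul_le_of_le_one_left hr (by linarith)
  linarith [mul_sq_mul_add_le (r := r) hM hD hη hη1,
    hν x ((1 - 2 * δ) * r) r (mul_nonneg (by linarith) hr) (by nlinarith [mul_nonneg hδ hr]),
    h₂₁ x ((1 - δ) * r) (mul_nonneg (by linarith) hr)]

theorem abs_ball_sub_ball_le_of_conv_le (hη : γ.real {u | δ * r ≤ ‖u‖} ≤ η) (hη1 : η ≤ 1 / 2)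
    (h₂₁ : ∀ (x : E) (R : ℝ), 0 ≤ R →
      (ν₂ ∗ γ).real (Metric.ball x R) ≤ (ν₁ ∗ γ).real (Metric.ball x R) + D * R ^ 2) (x : E) :
    |ν₁.real (Metric.ball x r) - ν₂.real (Metric.ball x r)|
      ≤ r ^ 2 * (6 * δ * M + 14 * η * M + 6 * D) := by
  have hη0 : 0 ≤ η := measureReal_nonneg.trans hη
  refine abs_sub_le_iff.2 ⟨ball_sub_le_of_conv_le hM hD hr hδ hδ1 hν h₁₂ hη hη1 x,
    (le_ball_sub_of_conv_le hM hD hr hδ hδ1 hν h₁₂ hη hη1 h₂₁ x).trans ?_⟩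
  gcongr <;> norm_num

end Smoothing

section Isometries

theorem measurable_isometryEquiv_apply (x : ℂ) : Measurable fun h : ℂ ≃ᵢ ℂ => h x :=
  (measurable_pi_apply x).comp (comap_measurable _)

theorem measurable_isometryEquiv_eval : Measurable fun p : (ℂ ≃ᵢ ℂ) × ℂ => p.1 p.2 :=
  (measurable_uncurry_of_continuous_of_measurable (u := fun (x : ℂ) (h : ℂ ≃ᵢ ℂ) => h x)
    (fun h => h.continuous) measurable_isometryEquiv_apply).comp measurable_swap

instance instMeasurableSingletonClassIsom : MeasurableSingletonClass (ℂ ≃ᵢ ℂ) where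
  measurableSet_singleton h := by
    have hdense : {h} = ⋂ n : ℕ, {k : ℂ ≃ᵢ ℂ | k (TopologicalSpace.denseSeq ℂ n)
        = h (TopologicalSpace.denseSeq ℂ n)} := by
      ext k
      simp only [Set.mem_singleton_iff, Set.mem_iInter, Set.mem_ofPred_eq]
      refine ⟨fun hk n => by rw [hk], fun hk => DFunLike.coe_injective ?_⟩
      exact (TopologicalSpace.denseRange_denseSeq ℂ).equalizer k.continuous h.continuous
        (funext hk)
    rw [hdense]
    exact MeasurableSet.iInter fun n =>
      measurable_isometryEquiv_apply _ (measurableSet_singleton _)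

theorem ρ_apply (θ : ℝ) (y : ℂ) : ρ θ y = Complex.exp (θ * Complex.I) * y := by
  simp [ρ, rotation_apply, Circle.coe_exp]

theorem τ_apply (v y : ℂ) : τ v y = y + v := rfl

theorem ρ_zero (θ : ℝ) : ρ θ 0 = 0 := by rw [ρ_apply, mul_zero]

theorem τ_zero (v : ℂ) : τ v 0 = v := by rw [τ_apply, zero_add]

theorem τ_one_ne_τ_neg_one : τ 1 ≠ τ (-1) := fun h => by
  have hzero := DFunLike.congr_fun h 0
  rw [τ_zero, τ_zero] at hzero
  norm_num [Complex.ext_iff] at hzero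

theorem ρ_ne_τ (θ : ℝ) {v : ℂ} (hv : v ≠ 0) : ρ θ ≠ τ v := fun h => by
  have hzero := DFunLike.congr_fun h 0
  rw [ρ_zero, τ_zero] at hzero
  exact hv hzero.symm

end Isometries

section Walk

variable {Ω : Type*} [MeasurableSpace Ω] {P : Measure Ω} {g : ℕ → Ω → (ℂ ≃ᵢ ℂ)}
  {μ : PMF (ℂ ≃ᵢ ℂ)}

theorem walk_zero {Ω : Type*} (g : ℕ → Ω → (ℂ ≃ᵢ ℂ)) : walk g 0 = fun _ => 0 := by
  funext ω
  simp [walk]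

theorem walk_succ {Ω : Type*} (g : ℕ → Ω → (ℂ ≃ᵢ ℂ)) (N : ℕ) :
    walk g (N + 1) = fun ω => g 0 ω (walk (fun j => g (j + 1)) N ω) := by
  funext ω
  simp [walk, List.ofFn_succ]

theorem measurable_walk (hg : ∀ j, Measurable (g j)) (N : ℕ) : Measurable (walk g N) := by
  induction N generalizing g with
  | zero => rw [walk_zero]; exact measurable_const
  | succ N ih =>
    rw [walk_succ]
    exact measurable_isometryEquiv_eval.comp ((hg 0).prodMk (ih fun j => hg (j + 1)))

theorem aemeasurable_walk (hg : ∀ j, AEMeasurable (g j) P) (N : ℕ) : AEMeasurable (walk g N) P := by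
  induction N generalizing g with
  | zero => rw [walk_zero]; exact aemeasurable_const
  | succ N ih =>
    rw [walk_succ]
    exact measurable_isometryEquiv_eval.comp_aemeasurable
      ((hg 0).prodMk (ih fun j => hg (j + 1)))

theorem IsIIDSample.shift (h : IsIIDSample P g μ) : IsIIDSample P (fun j => g (j + 1)) μ :=
  ⟨fun j => h.hasLaw (j + 1), h.indep.precomp (add_left_injective 1)⟩

theorem IsIIDSample.aemeasurable (h : IsIIDSample P g μ) (j : ℕ) : AEMeasurable (g j) P :=
  (h.hasLaw j).aemeasurable

theorem IsIIDSample.indepFun_walk [IsProbabilityMeasure P] (h : IsIIDSample P g μ) (N : ℕ) :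
    IndepFun (g 0) (walk (fun j => g (j + 1)) N) P := by
  set T : Finset ℕ := Finset.Icc 1 N
  -- The later steps as functions of `(g 1, …, g N)`, padded by the identity.
  set k : ℕ → ((i : T) → (ℂ ≃ᵢ ℂ)) → (ℂ ≃ᵢ ℂ) := fun j a =>
    if hj : j + 1 ∈ T then a ⟨j + 1, hj⟩ else 1 with hk
  have hkm : ∀ j, Measurable (k j) := fun j => by
    by_cases hj : j + 1 ∈ T
    · simp only [hk, hj, dite_true]
      exact measurable_pi_apply _
    · simp only [hk, hj, dite_false]
      exact measurable_const
  have hwalk : walk (fun j => g (j + 1)) N = walk k N ∘ fun ω (i : T) => g i ω := by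
    funext ω
    simp only [Function.comp_apply, walk]
    congr 2
    refine List.ofFn_inj.2 (funext fun j => ?_)
    have hj : (j : ℕ) + 1 ∈ T := Finset.mem_Icc.2 ⟨by omega, by omega⟩
    simp only [hk, hj, dite_true]
  rw [hwalk]
  exact (h.indep.indepFun_finset₀ {0} T (by simp [T]) h.aemeasurable).comp
    (measurable_pi_apply (⟨0, by simp⟩ : ({0} : Finset ℕ))) (measurable_walk hkm N)

theorem IsIIDSample.charFun_map_walk_succ [IsProbabilityMeasure P] (h : IsIIDSample P g μ) (N : ℕ)
    (ξ : ℂ) :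
    charFun (P.map (walk g (N + 1))) ξ = ∫ k, (∫ y, Complex.exp ((inner ℝ (k y) ξ : ℝ) * Complex.I)
      ∂(P.map (walk (fun j => g (j + 1)) N))) ∂μ.toMeasure := by
  have hY := aemeasurable_walk h.shift.aemeasurable N
  have : IsProbabilityMeasure (P.map (walk (fun j => g (j + 1)) N)) :=
    Measure.isProbabilityMeasure_map hY
  have hlaw := (indepFun_iff_map_prod_eq_prod_map_map (h.aemeasurable 0) hY).1 (h.indepFun_walk N)
  rw [(h.hasLaw 0).map_eq] at hlaw
  have hexp : Measurable fun p : (ℂ ≃ᵢ ℂ) × ℂ =>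
      Complex.exp ((inner ℝ (p.1 p.2) ξ : ℝ) * Complex.I) :=
    (by fun_prop : Measurable fun y : ℂ => Complex.exp ((inner ℝ y ξ : ℝ) * Complex.I)).comp
      measurable_isometryEquiv_eval
  rw [charFun_apply, integral_map (aemeasurable_walk h.aemeasurable _)
    (Measurable.aestronglyMeasurable (by fun_prop)), walk_succ,
    ← integral_prod (fun p : (ℂ ≃ᵢ ℂ) × ℂ => Complex.exp ((inner ℝ (p.1 p.2) ξ : ℝ) * Complex.I)),
    ← hlaw, integral_map ((h.aemeasurable 0).prodMk hY) hexp.aestronglyMeasurable]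
  refine Integrable.of_bound hexp.aestronglyMeasurable 1 (Filter.Eventually.of_forall fun p => ?_)
  rw [Complex.norm_exp_ofReal_mul_I]

end Walk

section StepLaw

theorem integral_exp_ρ (ν : Measure ℂ) (θ : ℝ) (ξ : ℂ) :
    ∫ y, Complex.exp ((inner ℝ (ρ θ y) ξ : ℝ) * Complex.I) ∂ν
      = charFun ν (conj (Complex.exp (θ * Complex.I)) * ξ) := by
  simp only [charFun_apply, ρ_apply, Complex.inner, map_mul]
  congr! 6
  ring

theorem integral_exp_τ_mul (ν : Measure ℂ) (v : ℂ) (k : ℂ ≃ᵢ ℂ) (ξ : ℂ) :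
    ∫ y, Complex.exp ((inner ℝ ((τ v * k) y) ξ : ℝ) * Complex.I) ∂ν
      = Complex.exp ((inner ℝ v ξ : ℝ) * Complex.I)
        * ∫ y, Complex.exp ((inner ℝ (k y) ξ : ℝ) * Complex.I) ∂ν := by
  rw [← integral_const_mul]
  refine integral_congr_ae (Filter.Eventually.of_forall fun y => ?_)
  simp only [IsometryEquiv.mul_apply, τ_apply]
  rw [← Complex.exp_add, inner_add_left]
  push_cast
  ring_nf

theorem integral_exp_τ (ν : Measure ℂ) (v ξ : ℂ) :
    ∫ y, Complex.exp ((inner ℝ (τ v y) ξ : ℝ) * Complex.I) ∂ν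
      = Complex.exp ((inner ℝ v ξ : ℝ) * Complex.I) * charFun ν ξ := by
  simpa [charFun_apply] using integral_exp_τ_mul ν v 1 ξ

theorem exp_inner_one_add_exp_inner_neg_one (ξ : ℂ) :
    Complex.exp ((inner ℝ (1 : ℂ) ξ : ℝ) * Complex.I)
      + Complex.exp ((inner ℝ (-1 : ℂ) ξ : ℝ) * Complex.I) = 2 * (Real.cos ξ.re : ℝ) := by
  rw [inner_neg_left]
  simp only [Complex.inner, map_one, mul_one]
  push_cast
  rw [Complex.two_cos]

namespace StepWeights

/-- The law of the random isometry with step probabilities `W` and rotation angle `φ`. It is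
dual to the rotation of frequencies by `u = exp (-φ i)` in `W.transfer u`. -/
noncomputable def law (W : StepWeights) (φ : ℝ) : Measure (ℂ ≃ᵢ ℂ) :=
  ENNReal.ofReal W.rot • Measure.dirac (ρ φ)
    + ENNReal.ofReal (W.rotFlip / 2) •
      (Measure.dirac (τ 1 * ρ φ) + Measure.dirac (τ (-1) * ρ φ))
    + ENNReal.ofReal W.back • Measure.dirac (ρ (-φ))
    + ENNReal.ofReal (W.flip / 2) • (Measure.dirac (τ 1) + Measure.dirac (τ (-1)))

variable (W : StepWeights) (φ : ℝ)

theorem integral_law {E : Type*} [NormedAddCommGroup E] [NormedSpace ℝ E] [CompleteSpace E]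
    (f : (ℂ ≃ᵢ ℂ) → E) :
    ∫ k, f k ∂W.law φ = W.rot • f (ρ φ)
      + (W.rotFlip / 2) • (f (τ 1 * ρ φ) + f (τ (-1) * ρ φ)) + W.back • f (ρ (-φ))
      + (W.flip / 2) • (f (τ 1) + f (τ (-1))) := by
  have hdirac : ∀ k, Integrable f (Measure.dirac k) := fun k => integrable_dirac (by simp)
  have hpair : ∀ k l, Integrable f (Measure.dirac k + Measure.dirac l) := fun k l =>
    (hdirac k).add_measure (hdirac l)
  have hsmul : ∀ {m : Measure (ℂ ≃ᵢ ℂ)} (a : ℝ), Integrable f m →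
      Integrable f (ENNReal.ofReal a • m) := fun _ hm => hm.smul_measure ENNReal.ofReal_ne_top
  have hrot := (hsmul W.rot (hdirac (ρ φ))).add_measure
    (hsmul (W.rotFlip / 2) (hpair (τ 1 * ρ φ) (τ (-1) * ρ φ)))
  have hback := hsmul W.back (hdirac (ρ (-φ)))
  rw [law, integral_add_measure (hrot.add_measure hback) (hsmul _ (hpair _ _)),
    integral_add_measure hrot hback,
    integral_add_measure (hsmul _ (hdirac _)) (hsmul _ (hpair _ _))]
  simp only [integral_smul_measure, integral_add_measure (hdirac _) (hdirac _), integral_dirac,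
    ENNReal.toReal_ofReal W.rot_nonneg, ENNReal.toReal_ofReal W.back_nonneg,
    ENNReal.toReal_ofReal (div_nonneg W.rotFlip_nonneg zero_le_two),
    ENNReal.toReal_ofReal (div_nonneg W.flip_nonneg zero_le_two)]

theorem integral_law_integral_exp {ν : Measure ℂ} {F : ℂ → ℝ} (hF : ∀ ξ, charFun ν ξ = F ξ)
    (ξ : ℂ) :
    ∫ k, (∫ y, Complex.exp ((inner ℝ (k y) ξ : ℝ) * Complex.I) ∂ν) ∂W.law φ
      = W.transfer (conj (Complex.exp (φ * Complex.I))) F ξ := by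
  have hneg : conj (Complex.exp (((-φ : ℝ) : ℂ) * Complex.I)) = Complex.exp (φ * Complex.I) := by
    simp [← Complex.exp_conj]
  rw [integral_law]
  simp only [integral_exp_τ_mul, integral_exp_τ, integral_exp_ρ, hF, ← add_mul,
    exp_inner_one_add_exp_inner_neg_one, hneg, transfer, meanWith, Complex.conj_conj,
    Complex.real_smul]
  push_cast
  ring

theorem stdDev_eq {μ : PMF (ℂ ≃ᵢ ℂ)} (hμ : μ.toMeasure = W.law φ) :
    stdDev μ = √(2 * W.halfVar) := by
  rw [stdDev, hμ, integral_law]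
  congr 1
  simp only [IsometryEquiv.mul_apply, ρ_zero, τ_zero, norm_zero, norm_one, norm_neg, smul_eq_mul,
    halfVar, flipProb]
  ring

end StepWeights

theorem IsIIDSample.charFun_map_walk {Ω : Type*} [MeasurableSpace Ω] {P : Measure Ω}
    [IsProbabilityMeasure P] {g : ℕ → Ω → (ℂ ≃ᵢ ℂ)} {μ : PMF (ℂ ≃ᵢ ℂ)} (h : IsIIDSample P g μ)
    {W : StepWeights} {φ : ℝ} (hμ : μ.toMeasure = W.law φ) (N : ℕ) (ξ : ℂ) :
    charFun (P.map (walk g N)) ξ = W.char (conj (Complex.exp (φ * Complex.I))) N ξ := by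
  induction N generalizing g ξ with
  | zero =>
    rw [walk_zero, Measure.map_const]
    simp [StepWeights.char, charFun_dirac]
  | succ N ih =>
    rw [h.charFun_map_walk_succ, hμ, W.integral_law_integral_exp φ (ih h.shift)]
    rfl

end StepLaw

section StepWeightsOfMeasure

theorem toMeasure_eq_sum_smul_dirac {α : Type*} [MeasurableSpace α] (μ : PMF α) {S : Finset α}
    (hS : μ.support ⊆ S) : μ.toMeasure = ∑ a ∈ S, μ a • Measure.dirac a := by
  ext T hT
  rw [PMF.toMeasure_apply _ hT, tsum_eq_sum (s := S)]
  · simp only [Measure.coe_finsetSum, Finset.sum_apply, Measure.smul_apply, smul_eq_mul,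
      Measure.dirac_apply' _ hT]
    refine Finset.sum_congr rfl fun a _ => ?_
    by_cases ha : a ∈ T <;> simp [ha]
  · intro a ha
    have hzero : μ a = 0 := (μ.apply_eq_zero_iff a).2 fun h => ha (hS h)
    by_cases h : a ∈ T <;> simp [h, hzero]

theorem support_subset_iff_sum_eq_one {α : Type*} (μ : PMF α) (S : Finset α) :
    μ.support ⊆ S ↔ ∑ a ∈ S, μ a = 1 := by
  rw [← PMF.toOuterMeasure_apply_finset, PMF.toOuterMeasure_apply_eq_one_iff]

variable {θ : ℝ} {μ : PMF (ℂ ≃ᵢ ℂ)}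

theorem IsLittlewood.exists_toMeasure_eq_law (h : IsLittlewood θ μ) :
    ∃ W : StepWeights, μ.toMeasure = W.law θ := by
  classical
  have hne : τ 1 * ρ θ ≠ τ (-1) * ρ θ := fun e => τ_one_ne_τ_neg_one (mul_right_cancel e)
  have hsupp : μ.support ⊆ ({τ 1 * ρ θ, τ (-1) * ρ θ} : Finset (ℂ ≃ᵢ ℂ)) := by
    rw [support_subset_iff_sum_eq_one, Finset.sum_pair hne, h.1, h.2,
      ENNReal.inv_two_add_inv_two]
  refine ⟨⟨0, 1, 0, 0, le_rfl, zero_le_one, le_rfl, le_rfl, by norm_num, by norm_num,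
    by norm_num⟩, ?_⟩
  rw [toMeasure_eq_sum_smul_dirac μ hsupp, Finset.sum_pair hne, h.1, h.2]
  simp [StepWeights.law]

open Classical in
theorem IsAsymmetricWreath.sum_eq (h : IsAsymmetricWreath θ μ) {M : Type*} [AddCommMonoid M]
    (f : (ℂ ≃ᵢ ℂ) → M) :
    ∑ k ∈ {ρ θ, ρ (-θ), τ 1, τ (-1)}, f k
      = f (ρ θ) + f (ρ (-θ)) + (f (τ 1) + f (τ (-1))) := by
  have hne : ρ θ ≠ ρ (-θ) := fun e => h.rotation_ne (congrArg μ e)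
  rw [Finset.sum_insert (by simp [ρ_ne_τ, hne]), Finset.sum_insert (by simp [ρ_ne_τ]),
    Finset.sum_pair τ_one_ne_τ_neg_one, add_assoc]

theorem IsAsymmetricWreath.neg (h : IsAsymmetricWreath θ μ) : IsAsymmetricWreath (-θ) μ where
  support_eq := by rw [h.support_eq, neg_neg, Set.insert_comm]
  translation_eq := h.translation_eq
  rotation_ne := by rw [neg_neg]; exact h.rotation_ne.symm

theorem IsAsymmetricWreath.exists_toMeasure_eq_law_of_lt (h : IsAsymmetricWreath θ μ)
    (hlt : μ (ρ (-θ)) < μ (ρ θ)) : ∃ W : StepWeights, μ.toMeasure = W.law θ := by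
  classical
  have hsupp : μ.support ⊆ ({ρ θ, ρ (-θ), τ 1, τ (-1)} : Finset (ℂ ≃ᵢ ℂ)) := by
    simp [h.support_eq]
  have htop := μ.apply_ne_top
  have hτ : 0 < (μ (τ 1)).toReal :=
    ENNReal.toReal_pos (by rw [← μ.mem_support_iff, h.support_eq]; simp) (htop _)
  have hsum : (μ (ρ θ)).toReal + (μ (ρ (-θ))).toReal
      + ((μ (τ 1)).toReal + (μ (τ 1)).toReal) = 1 := by
    have hone := congrArg ENNReal.toReal ((support_subset_iff_sum_eq_one μ _).1 hsupp)
    rwa [ENNReal.toReal_sum fun k _ => htop k, h.sum_eq, ← h.translation_eq,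
      ENNReal.toReal_one] at hone
  refine ⟨⟨(μ (ρ θ)).toReal, 0, (μ (ρ (-θ))).toReal, 2 * (μ (τ 1)).toReal,
    ENNReal.toReal_nonneg, le_rfl, ENNReal.toReal_nonneg, by positivity, by linarith,
    by simpa using (ENNReal.toReal_lt_toReal (htop _) (htop _)).2 hlt, by simpa using hτ⟩, ?_⟩
  rw [toMeasure_eq_sum_smul_dirac μ hsupp, h.sum_eq, ← h.translation_eq]
  simp [StepWeights.law, ENNReal.ofReal_toReal (htop _), add_assoc]

theorem IsAsymmetricWreath.exists_toMeasure_eq_law (h : IsAsymmetricWreath θ μ) :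
    ∃ (W : StepWeights) (φ : ℝ), Real.cos φ = Real.cos θ ∧ μ.toMeasure = W.law φ := by
  rcases lt_or_gt_of_ne h.rotation_ne with hlt | hlt
  · obtain ⟨W, hW⟩ := h.neg.exists_toMeasure_eq_law_of_lt (by rwa [neg_neg])
    exact ⟨W, -θ, Real.cos_neg θ, hW⟩
  · obtain ⟨W, hW⟩ := h.exists_toMeasure_eq_law_of_lt hlt
    exact ⟨W, θ, rfl, hW⟩

theorem exists_toMeasure_eq_law (h : IsLittlewood θ μ ∨ IsAsymmetricWreath θ μ) :
    ∃ (W : StepWeights) (φ : ℝ), Real.cos φ = Real.cos θ ∧ μ.toMeasure = W.law φ :=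
  h.elim (fun h => h.exists_toMeasure_eq_law.imp fun _ hW => ⟨θ, rfl, hW⟩)
    (·.exists_toMeasure_eq_law)

end StepWeightsOfMeasure

section LocalLimit

theorem exists_pow_mul_exp_neg_sqrt_le {c : ℝ} (hc : 0 < c) (k : ℕ) :
    ∃ K : ℝ, 0 < K ∧ ∀ N : ℕ, (N : ℝ) ^ k * Real.exp (-(c * √N)) ≤ K := by
  refine ⟨(2 * k).factorial / c ^ (2 * k), by positivity, fun N => ?_⟩
  have hpow := Real.pow_div_factorial_le_exp (c * √N) (by positivity) (2 * k)
  rw [mul_pow, pow_mul √N, Real.sq_sqrt N.cast_nonneg, div_le_iff₀ (by positivity)] at hpow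
  rw [Real.exp_neg, ← div_eq_mul_inv, div_le_div_iff₀ (Real.exp_pos _) (by positivity)]
  linarith

theorem exp_neg_two_mul_mul_le {a t : ℝ} (ha : 0 < a) (ht : 0 ≤ t) :
    Real.exp (-(2 * a) * t) * (13 + 4 * t) ≤ (13 + 4 / a) * Real.exp (-a * t) := by
  have hle : 13 + 4 * t ≤ (13 + 4 / a) * Real.exp (a * t) :=
    calc 13 + 4 * t = 13 * 1 + 4 / a * (a * t) := by field_simp
      _ ≤ 13 * Real.exp (a * t) + 4 / a * Real.exp (a * t) := by
          gcongr
          · exact Real.one_le_exp (by positivity)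
          · linarith [Real.add_one_le_exp (a * t)]
      _ = _ := by ring
  calc Real.exp (-(2 * a) * t) * (13 + 4 * t)
      ≤ Real.exp (-(2 * a) * t) * ((13 + 4 / a) * Real.exp (a * t)) := by gcongr
    _ = (13 + 4 / a) * Real.exp (-a * t) := by
        rw [mul_left_comm, ← Real.exp_add]
        ring_nf

theorem thirteen_add_mul_mul_le {Q y : ℝ} (hQ : 1 ≤ Q) (hy : 0 ≤ y) (hyQ : y ≤ Q) :
    (13 + 16 * y) * y ≤ 29 * Q ^ 2 :=
  calc (13 + 16 * y) * y ≤ (13 * Q + 16 * Q) * Q := by gcongr; linarith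
    _ = 29 * Q ^ 2 := by ring

theorem high_frequency_error_le {c K r : ℝ} {N : ℕ} (hc : 0 ≤ c) (hN : 0 < N)
    (hK : (N : ℝ) ^ 10 * Real.exp (-(c / 2 * √N)) ≤ K) (hr : Real.exp (-(c / 8) * √N) ≤ r) :
    (13 + 16 / (r / (8 * N ^ 2)) ^ 2) * Real.exp (-c * √N)
        * (Real.pi / ((r / (8 * N ^ 2)) ^ 2 / 4)) ≤ 29 * 4 * 4096 * Real.pi * K / N ^ 2 := by
  have hr0 : 0 < r := (Real.exp_pos _).trans_le hr
  have hN1 : (1 : ℝ) ≤ N := by exact_mod_cast hN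
  set y := 64 * (N : ℝ) ^ 4 / r ^ 2
  set Q := 64 * (N : ℝ) ^ 4 * Real.exp (c / 4 * √N)
  have hyQ : y ≤ Q := by
    have hinv : (r ^ 2)⁻¹ ≤ Real.exp (c / 4 * √N) := by
      rw [show c / 4 * √N = -((2 : ℕ) * (-(c / 8) * √N)) by push_cast; ring, Real.exp_neg,
        Real.exp_nat_mul]
      gcongr
    exact mul_le_mul_of_nonneg_left hinv (by positivity)
  have hQ1 : 1 ≤ Q := by
    have hpow : 1 ≤ (N : ℝ) ^ 4 := one_le_pow₀ hN1
    exact one_le_mul_of_one_le_of_one_le (by linarith) (Real.one_le_exp (by positivity))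
  have hQ2 : Q ^ 2 * Real.exp (-c * √N) * N ^ 2
      = 4096 * ((N : ℝ) ^ 10 * Real.exp (-(c / 2 * √N))) := by
    rw [show -(c / 2 * √N) = (2 : ℕ) * (c / 4 * √N) + -c * √N by push_cast; ring, Real.exp_add,
      Real.exp_nat_mul]
    ring
  rw [le_div_iff₀ (by positivity)]
  calc _ = 4 * Real.pi * ((13 + 16 * y) * y) * Real.exp (-c * √N) * N ^ 2 := by
        simp only [y]; field_simp; ring
    _ ≤ 4 * Real.pi * (29 * Q ^ 2) * Real.exp (-c * √N) * N ^ 2 := by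
        gcongr 4 * Real.pi * ?_ * _ * _
        exact thirteen_add_mul_mul_le hQ1 (by positivity) hyQ
    _ = 29 * 4 * Real.pi * (Q ^ 2 * Real.exp (-c * √N) * N ^ 2) := by ring
    _ ≤ 29 * 4 * Real.pi * (4096 * K) := by rw [hQ2]; gcongr
    _ = 29 * 4 * 4096 * Real.pi * K := by ring

variable {u : ℂ} (W : StepWeights) (hu : ‖u‖ = 1) (hrat : ∃ q : ℚ, u.re = q)
  (hhalf : ¬ ∃ k : ℤ, u.re = k / 2)

namespace StepWeights

include hu hrat hhalf

theorem exists_abs_char_sub_exp_le_of_le_norm {κ : ℝ} (hκ : 0 < κ) :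
    ∃ c : ℝ, 0 < c ∧ ∀ (n : ℕ) (ξ : ℂ), κ ≤ ‖ξ‖ →
      |W.char u n ξ - Real.exp (-(n * W.halfVar * ‖ξ‖ ^ 2))|
        ≤ (13 + 4 * ‖ξ‖ ^ 2) * Real.exp (-c * √n) := by
  obtain ⟨c, hc, hhigh⟩ := W.exists_abs_char_le hu hrat hhalf hκ
  have hq := W.halfVar_pos
  refine ⟨min c (W.halfVar * κ ^ 2), by positivity, fun n ξ hξ => ?_⟩
  set c' := min c (W.halfVar * κ ^ 2)
  have hsqrt : √(n : ℝ) ≤ n :=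
    Real.sqrt_le_iff.2 ⟨n.cast_nonneg, by exact_mod_cast Nat.le_self_pow two_ne_zero n⟩
  have hgauss : Real.exp (-(n * W.halfVar * ‖ξ‖ ^ 2)) ≤ Real.exp (-c' * √n) := by
    refine Real.exp_le_exp.2 ?_
    rw [neg_mul, neg_le_neg_iff]
    calc c' * √n ≤ W.halfVar * ‖ξ‖ ^ 2 * n := by
          gcongr
          exact (min_le_right _ _).trans (by gcongr)
      _ = n * W.halfVar * ‖ξ‖ ^ 2 := by ring
  calc _ ≤ |W.char u n ξ| + |Real.exp (-(n * W.halfVar * ‖ξ‖ ^ 2))| := abs_sub _ _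
    _ ≤ 8 * (‖ξ‖ + 1) * Real.exp (-c' * √n) + Real.exp (-c' * √n) := by
        rw [Real.abs_exp]
        refine add_le_add ((hhigh n ξ hξ).trans ?_) hgauss
        gcongr
        exact min_le_left _ _
    _ = (8 * (‖ξ‖ + 1) + 1) * Real.exp (-c' * √n) := by ring
    _ ≤ _ := by
        gcongr ?_ * _
        linarith [sq_nonneg (‖ξ‖ - 1)]

theorem exists_exp_mul_abs_char_sub_exp_le :
    ∃ A : ℝ, 0 < A ∧ ∃ c : ℝ, 0 < c ∧ ∀ N : ℕ, 0 < N → ∀ s : ℝ, 0 < s → ∀ ξ : ℂ,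
      Real.exp (-(s ^ 2 / 2) * ‖ξ‖ ^ 2)
          * |W.char u N ξ - Real.exp (-(N * W.halfVar * ‖ξ‖ ^ 2))|
        ≤ A / N * Real.exp (-(W.halfVar / 4 * N) * ‖ξ‖ ^ 2)
          + (13 + 16 / s ^ 2) * Real.exp (-c * √N) * Real.exp (-(s ^ 2 / 4) * ‖ξ‖ ^ 2) := by
  obtain ⟨κ, hκ, A, hA, hlow⟩ :=
    W.exists_abs_char_sub_exp_le hu (im_ne_zero_of_norm_eq_one hu hhalf)
  obtain ⟨c, hc, hhigh⟩ := W.exists_abs_char_sub_exp_le_of_le_norm hu hrat hhalf hκ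
  refine ⟨A, hA, c, hc, fun N hN s hs ξ => ?_⟩
  rcases le_total ‖ξ‖ κ with hξ | hξ
  · refine le_add_of_le_of_nonneg ?_ (by positivity)
    have hdamp : Real.exp (-(s ^ 2 / 2) * ‖ξ‖ ^ 2) ≤ 1 :=
      Real.exp_le_one_iff.2 (by rw [neg_mul]; exact neg_nonpos.2 (by positivity))
    rw [neg_mul (W.halfVar / 4 * N)]
    exact (mul_le_of_le_one_left (abs_nonneg _) hdamp).trans (hlow N hN ξ hξ)
  · refine le_add_of_nonneg_of_le (by positivity) ?_
    have hdamp := exp_neg_two_mul_mul_le (a := s ^ 2 / 4) (t := ‖ξ‖ ^ 2) (by positivity)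
      (by positivity)
    calc _ ≤ Real.exp (-(s ^ 2 / 2) * ‖ξ‖ ^ 2)
          * ((13 + 4 * ‖ξ‖ ^ 2) * Real.exp (-c * √N)) := by gcongr; exact hhigh N ξ hξ
      _ = Real.exp (-(2 * (s ^ 2 / 4)) * ‖ξ‖ ^ 2) * (13 + 4 * ‖ξ‖ ^ 2) * Real.exp (-c * √N) := by
          ring_nf
      _ ≤ (13 + 4 / (s ^ 2 / 4)) * Real.exp (-(s ^ 2 / 4) * ‖ξ‖ ^ 2) * Real.exp (-c * √N) := by
          gcongr
      _ = _ := by field_simp; norm_num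

theorem exists_abs_integral_gaussianKernel_sub_le :
    ∃ c : ℝ, 0 < c ∧ ∃ D : ℝ, 0 < D ∧ ∀ N : ℕ, 0 < N → ∀ (ν : Measure ℂ) [IsProbabilityMeasure ν],
      (∀ ξ, charFun ν ξ = W.char u N ξ) → ∀ (x : ℂ) (r : ℝ), Real.exp (-c * √N) ≤ r →
        |∫ y, gaussianKernel (r / (8 * N ^ 2)) (x - y) ∂ν
          - ∫ y, gaussianKernel (r / (8 * N ^ 2)) (x - y)
              ∂(planarGaussian (√(2 * W.halfVar) * √N))| ≤ D / N ^ 2 := by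
  obtain ⟨A, hA, c, hc, hdom⟩ := W.exists_exp_mul_abs_char_sub_exp_le hu hrat hhalf
  obtain ⟨K, hK, hKN⟩ := exists_pow_mul_exp_neg_sqrt_le (half_pos hc) 10
  have hq := W.halfVar_pos
  refine ⟨c / 8, by positivity, 4 * Real.pi * A / W.halfVar + 29 * 4 * 4096 * Real.pi * K,
    by positivity, fun N hN ν _ hν x r hr => ?_⟩
  have hr0 : 0 < r := (Real.exp_pos _).trans_le hr
  have hN0 : (0 : ℝ) < N := by exact_mod_cast hN
  have hS : 0 < √(2 * W.halfVar) * √N := by positivity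
  have := isProbabilityMeasure_planarGaussian hS
  have herror := high_frequency_error_le hc.le hN (hKN N) hr
  set s := r / (8 * (N : ℝ) ^ 2)
  have hs : 0 < s := by positivity
  have hlow := (integrable_exp_neg_mul_sq_norm (b := W.halfVar / 4 * N)
    (by positivity)).const_mul (A / N)
  have hhigh := (integrable_exp_neg_mul_sq_norm (b := s ^ 2 / 4) (by positivity)).const_mul
    ((13 + 16 / s ^ 2) * Real.exp (-c * √N))
  refine (abs_integral_gaussianKernel_sub_le hs ν _ (hlow.add hhigh) (fun ξ => ?_) x).trans ?_
  · refine le_trans (le_of_eq ?_) (hdom N hN s hs ξ)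
    rw [hν, charFun_planarGaussian hS, ← Complex.ofReal_neg, ← Complex.ofReal_exp,
      ← Complex.ofReal_sub, Complex.norm_real, Real.norm_eq_abs, mul_pow,
      Real.sq_sqrt (by positivity), Real.sq_sqrt (by positivity)]
    ring_nf
  · rw [integral_add' hlow hhigh, integral_const_mul, integral_const_mul,
      integral_exp_neg_mul_sq_norm (by positivity), integral_exp_neg_mul_sq_norm (by positivity),
      add_div]
    refine add_le_add (le_of_eq ?_) herror
    field_simp

theorem exists_abs_ball_sub_planarGaussian_ball_le :
    ∃ c : ℝ, 0 < c ∧ ∃ C : ℝ, 0 < C ∧ ∀ N : ℕ, 0 < N → ∀ (ν : Measure ℂ) [IsProbabilityMeasure ν],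
      (∀ ξ, charFun ν ξ = W.char u N ξ) → ∀ (x : ℂ) (r : ℝ), Real.exp (-c * √N) ≤ r →
        |ν.real (Metric.ball x r)
            - (planarGaussian (√(2 * W.halfVar) * √N)).real (Metric.ball x r)|
          ≤ C * r ^ 2 / N ^ 2 := by
  obtain ⟨c, hc, D, hD, hkernel⟩ := W.exists_abs_integral_gaussianKernel_sub_le hu hrat hhalf
  have hq := W.halfVar_pos
  set m := 1 / (4 * W.halfVar) with hm
  refine ⟨c, hc, 10 * m + 6 * (Real.pi * D), by positivity, fun N hN ν _ hν x r hr => ?_⟩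
  have hr0 : 0 < r := (Real.exp_pos _).trans_le hr
  have hN1 : (1 : ℝ) ≤ N := by exact_mod_cast hN
  have hDN : 0 ≤ D / N ^ 2 := by positivity
  set S := √(2 * W.halfVar) * √N with hS_def
  have hS : 0 < S := by positivity
  have hs : 0 < r / (8 * (N : ℝ) ^ 2) := by positivity
  have := isProbabilityMeasure_planarGaussian hS
  have := isProbabilityMeasure_planarGaussian hs
  have hM : (2 * S ^ 2)⁻¹ = m / N := by
    rw [hS_def, mul_pow, Real.sq_sqrt (by positivity), Real.sq_sqrt (by positivity), hm]
    field_simp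
    norm_num
  have htail : (planarGaussian (r / (8 * N ^ 2))).real {u | 1 / (2 * N) * r ≤ ‖u‖}
      ≤ 1 / (2 * N ^ 2) :=
    (planarGaussian_tail_le hs (by positivity)).trans (le_of_eq (by field_simp; norm_num))
  refine (abs_ball_sub_ball_le_of_conv_le (by positivity) (by positivity) hr0.le (by positivity)
    (one_div_le_one_div_of_le two_pos (by linarith))
    (fun y R R' => planarGaussian_real_ball_le hS y)
    (fun y R => conv_planarGaussian_real_ball_le ν _ hs hDN (hkernel N hN ν hν · r hr) y)
    htail (one_div_le_one_div_of_le two_pos (by nlinarith))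
    (fun y R => conv_planarGaussian_real_ball_le _ ν hs hDN
      (fun z => abs_sub_comm _ _ |>.trans_le (hkernel N hN ν hν z r hr)) y) x).trans ?_
  rw [hM]
  calc _ = r ^ 2 / N ^ 2 * (3 * m + 7 * (m / N) + 6 * (Real.pi * D)) := by field_simp; ring
    _ ≤ r ^ 2 / N ^ 2 * (3 * m + 7 * m + 6 * (Real.pi * D)) := by
        gcongr; exact div_le_self (by positivity) hN1
    _ = _ := by ring

end StepWeights

end LocalLimit

theorem map_walk_real_ball {Ω : Type*} [MeasurableSpace Ω] {P : Measure Ω}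
    {g : ℕ → Ω → (ℂ ≃ᵢ ℂ)} (hg : ∀ j, AEMeasurable (g j) P) (N : ℕ) (x : ℂ) (r : ℝ) :
    (P.map (walk g N)).real (Metric.ball x r) = P.real {ω | walk g N ω ∈ Metric.ball x r} :=
  map_measureReal_apply_of_aemeasurable (aemeasurable_walk hg N)
    Metric.isOpen_ball.measurableSet

theorem planarGaussian_real_ball {s : ℝ} (hs : 0 < s) (x : ℂ) (r : ℝ) :
    (planarGaussian s).real (Metric.ball x r)
      = (stdGaussian ℂ).real {z : ℂ | s • z ∈ Metric.ball x r} := by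
  rw [← map_smul_stdGaussian hs,
    map_measureReal_apply (by fun_prop) Metric.isOpen_ball.measurableSet]
  rfl

theorem exp_neg_mul_sqrt_le {c : ℝ} (hc : 0 ≤ c) {N : ℕ} (hN : 2 ≤ N) :
    Real.exp (-c * √N) ≤ Real.exp (-(c * Real.log 2) * √N / Real.log N) := by
  have hlog2 : 0 < Real.log 2 := Real.log_pos one_lt_two
  have hlog : Real.log 2 ≤ Real.log N := Real.log_le_log two_pos (by exact_mod_cast hN)
  rw [Real.exp_le_exp, le_div_iff₀ (hlog2.trans_le hlog)]
  linarith [mul_le_mul_of_nonneg_left hlog (by positivity : 0 ≤ c * √N)]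

theorem inv_sq_le_rpow {N : ℝ} (hN : 1 ≤ N) : (N ^ 2)⁻¹ ≤ N ^ (-(3 / 2) : ℝ) := by
  rw [← Real.rpow_natCast, ← Real.rpow_neg (by linarith)]
  exact Real.rpow_le_rpow_of_exponent_le hN (by norm_num)

end PlanarWalk

open PlanarWalk ComplexConjugate in
theorem theorem3_general (W : StepWeights) (φ : ℝ) (μ : PMF (ℂ ≃ᵢ ℂ)) (hμ : μ.toMeasure = W.law φ)
    (hrat : ∃ q : ℚ, Real.cos φ = q)
    (hhalf : ¬ ∃ k : ℤ, Real.cos φ = k / 2) :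
    ∃ c : ℝ, 0 < c ∧ ∃ C : ℝ, 0 < C ∧
      ∀ {Ω : Type*} [MeasurableSpace Ω] (P : Measure Ω) [IsProbabilityMeasure P]
        (g : ℕ → Ω → (ℂ ≃ᵢ ℂ)), IsIIDSample P g μ →
      ∀ N : ℕ, 0 < N → ∀ (x₀ : ℂ) (r : ℝ), Real.exp (-c * √N) ≤ r →
        |P.real {ω | walk g N ω ∈ Metric.ball x₀ r}
            - (stdGaussian ℂ).real {z : ℂ | (stdDev μ * √N) • z ∈ Metric.ball x₀ r}|
          ≤ C * r ^ 2 / N ^ 2 := by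
  have hu : ‖conj (Complex.exp (φ * Complex.I))‖ = 1 := by
    rw [RCLike.norm_conj, Complex.norm_exp_ofReal_mul_I]
  have hre : (conj (Complex.exp (φ * Complex.I))).re = Real.cos φ := by
    rw [Complex.conj_re, Complex.exp_ofReal_mul_I_re]
  rw [← hre] at hrat hhalf
  obtain ⟨c, hc, C, hC, hlimit⟩ := W.exists_abs_ball_sub_planarGaussian_ball_le hu hrat hhalf
  refine ⟨c, hc, C, hC, fun P _ g hg N hN x₀ r hr => ?_⟩
  have := Measure.isProbabilityMeasure_map (aemeasurable_walk hg.aemeasurable N)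
  have hσ : 0 < √(2 * W.halfVar) * √N := by have := W.halfVar_pos; positivity
  rw [← map_walk_real_ball hg.aemeasurable, W.stdDev_eq φ hμ, ← planarGaussian_real_ball hσ]
  exact hlimit N hN _ (hg.charFun_map_walk hμ N) x₀ r hr

open PlanarWalk in
theorem theorem3 (θ : ℝ) (μ : PMF (ℂ ≃ᵢ ℂ))
    (hμ : IsLittlewood θ μ ∨ IsAsymmetricWreath θ μ)
    (hrat : ∃ q : ℚ, Real.cos θ = q)
    (hhalf : ¬ ∃ k : ℤ, Real.cos θ = k / 2) :
    ∃ c : ℝ, 0 < c ∧ ∃ C : ℝ, 0 < C ∧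
      ∀ {Ω : Type*} [MeasurableSpace Ω] (P : Measure Ω) [IsProbabilityMeasure P]
        (g : ℕ → Ω → (ℂ ≃ᵢ ℂ)), IsIIDSample P g μ →
      ∀ N : ℕ, 2 ≤ N → ∀ (x₀ : ℂ) (r : ℝ), Real.exp (-c * √N / Real.log N) < r →
        |P.real {ω | walk g N ω ∈ Metric.ball x₀ r}
            - (stdGaussian ℂ).real {z : ℂ | (stdDev μ * √N) • z ∈ Metric.ball x₀ r}|
          ≤ C * (N : ℝ) ^ (-(3 / 2) : ℝ) * r ^ 2 := by
  obtain ⟨W, φ, hφ, hW⟩ := exists_toMeasure_eq_law hμ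
  rw [← hφ] at hrat hhalf
  obtain ⟨c, hc, C, hC, hlimit⟩ := theorem3_general W φ μ hW hrat hhalf
  refine ⟨c * Real.log 2, mul_pos hc (Real.log_pos one_lt_two), C, hC,
    fun P _ g hg N hN x₀ r hr => ?_⟩
  refine (hlimit P g hg N (by omega) x₀ r ((exp_neg_mul_sqrt_le hc.le hN).trans hr.le)).trans ?_
  rw [mul_right_comm, div_eq_mul_inv]
  gcongr
  exact inv_sq_le_rpow (by exact_mod_cast (by omega : 1 ≤ N))
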